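/- Let $v:\mathbb R\to\mathbb R$ be a smooth ($C^\infty$) $1$-periodic function with $\max_{\mathbb R}v=0$, and let $\mu\in\mathbb R$ satisfy $|\mu|<\int_0^1\sqrt{(1-v(y))^2-1}\,dy$. Put $\mathcal M_0=\{x\in[0,1): v(x)=0\}$ and assume that $\mathcal M_0$ is finite and that the values $v''(x)$, $x\in\mathcal M_0$, are pairwise distinct. Then: 1. For every $d>0$ there is exactly one pair $(\overline H_d,w_d)$ of a real number $\overline H_d$ and a $1$-periodic function $w_d\in C^2(\mathbb R)$ with $w_d(0)=0$ such that $$-\frac{d\,w_d''}{1+(\mu+w_d')^2}+\sqrt{1+(\mu+w_d')^2}+v(y)=\overline H_d\quad\text{in }\mathbb R .$$ 2. There is a unique $\bar x\in\mathcal M_0$ with $|v''(\bar x)|=\min_{x\in\mathcal M_0}|v''(x)|$, and a unique $x_\mu\in(\bar x,\bar x+1)$ with $$\int_{\bar x}^{x_\mu}\sqrt{(1-v)^2-1}\,dy-\int_{x_\mu}^{\bar x+1}\sqrt{(1-v)^2-1}\,dy=\mu .$$ 3. Let $w_0$ be the $1$-periodic function given on $[\bar x,\bar x+1]$ by $$w_0(x)=\begin{cases}\displaystyle\int_{\bar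 x}^{x}\sqrt{(1-v)^2-1}\,dy-\mu x, & x\in[\bar x,x_\mu],\\[2mm] \displaystyle\int_{\bar x}^{x_\mu}\sqrt{(1-v)^2-1}\,dy-\int_{x_\mu}^{x}\sqrt{(1-v)^2-1}\,dy-\mu x, & x\in[x_\mu,\bar x+1].\end{cases}$$ Then $w_0$ is a viscosity solution of $\sqrt{1+(\mu+w_0')^2}+v=1$ in $\mathbb R$, and $$\lim_{d\to0^+}w_d(x)=w_0(x)-w_0(0)\quad\text{uniformly in }x\in\mathbb R .$$ -/

import Mathlib

open Set Filter Topology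

noncomputable section

namespace GEquation

/-- `w` is a `C²`, `1`-periodic solution, normalized by `w 0 = 0`, of the cell problem
`-d w'' / (1 + (μ + w')²) + √(1 + (μ + w')²) + v = H` on `ℝ`
(shear flow with profile `v`, direction `p = (1, μ)`, Markstein number `d`). -/
structure IsCellSolution (v : ℝ → ℝ) (μ d H : ℝ) (w : ℝ → ℝ) : Prop where
  contDiff : ContDiff ℝ 2 w
  periodic : Function.Periodic w 1
  normalized : w 0 = 0
  equation : ∀ y : ℝ,
    -(d * deriv (deriv w) y / (1 + (μ + deriv w y) ^ 2))
      + √(1 + (μ + deriv w y) ^ 2) + v y = H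

/-- `w` is a (continuous) viscosity solution on `ℝ` of the inviscid equation
`√(1 + (μ + w')²) + v = H`: subsolution and supersolution tests with `C¹` functions
touching from above and from below. -/
structure IsInviscidViscositySolution (v : ℝ → ℝ) (μ H : ℝ) (w : ℝ → ℝ) : Prop where
  continuous : Continuous w
  subsolution : ∀ (φ : ℝ → ℝ) (y : ℝ), ContDiff ℝ 1 φ →
    IsLocalMax (fun x => w x - φ x) y → √(1 + (μ + deriv φ y) ^ 2) + v y ≤ H
  supersolution : ∀ (φ : ℝ → ℝ) (y : ℝ), ContDiff ℝ 1 φ →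
    IsLocalMin (fun x => w x - φ x) y → H ≤ √(1 + (μ + deriv φ y) ^ 2) + v y

/-- The maximum points of `v` in the period cell `[0, 1)`. -/
def maxPoints (v : ℝ → ℝ) : Set ℝ :=
  {x | x ∈ Ico (0 : ℝ) 1 ∧ ∀ y : ℝ, v y ≤ v x}

/-- The inviscid slope `√((1 - v)² - 1)`. -/
def slope (v : ℝ → ℝ) (y : ℝ) : ℝ := √((1 - v y) ^ 2 - 1)

/-- The balance condition that determines the point `z = x_μ`:
the slope integrates over `[a, z]` and over `[z, a + 1]` to quantities with difference `μ`. -/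
def IsBalanced (v : ℝ → ℝ) (μ a z : ℝ) : Prop :=
  (∫ y in a..z, slope v y) - (∫ y in z..(a + 1), slope v y) = μ

/-- The piecewise formula on the cell `[a, a + 1]`. -/
def cellProfile (v : ℝ → ℝ) (μ a z x : ℝ) : ℝ :=
  if x ≤ z then (∫ y in a..x, slope v y) - μ * x
  else (∫ y in a..z, slope v y) - (∫ y in z..x, slope v y) - μ * x

/-- The `1`-periodic function that equals `cellProfile v μ a z` on `[a, a + 1)`. -/
def physicalSolution (v : ℝ → ℝ) (μ a z x : ℝ) : ℝ :=
  cellProfile v μ a z (toIcoMod (zero_lt_one' ℝ) a x)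

end GEquation

end

/-!
In terms of `u = μ + w'` the cell problem is the first-order periodic equation
`d u' = (1 + u²) (√(1 + u²) + v - H)` with mean `μ`. Its right-hand side decreases in `H`, so two
periodic solutions that touch have the same level and coincide; two solutions of equal mean do
touch, which gives uniqueness. For existence, the pairs (initial value, level) that
start a periodic solution form a compact set projecting onto a whole interval of initial values,
and the means take values on both sides of `μ`; as an initial value determines its level, `μ` is
attained by connectedness.

As `d → 0`, an energy identity bounds the residual `√(1 + u²) + v - H` in `L²` by `O(d)`, so
`H → 1` and `|u| → slope v` in `L¹`; only the sign of `u` is left to determine. At the flattest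
maximum `a`, comparison with the line `κ (x - a)` gives `1 - H ≤ d κ` whenever `κ² > |v'' a|`.
Every other maximum in `(a, a + 1)` is steeper, so some barrier inside the band `|y| < slope v`
has derivative `κ` at these maxima, and by the bound on `H` the solution `u` can cross it only
downwards. Hence `u` switches from positive to negative essentially once on `(a, a + 1)`, and the
mean `μ` determines where.
-/

namespace GEquation

lemma pos_of_deriv_pos_of_eq_zero {f f' : ℝ → ℝ} {a b : ℝ} (hab : a < b)
    (hf : ∀ x ∈ Icc a b, HasDerivWithinAt f (f' x) (Icc a b) x)
    (hpos : ∀ x ∈ Icc a b, f x = 0 → 0 < f' x) (ha : 0 ≤ f a) : 0 < f b := by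
  have hb : b ∈ Icc a b := right_mem_Icc.2 hab.le
  have hnonneg : ∀ x ∈ Icc a b, 0 ≤ f x := by
    have hneg : ∀ x ∈ Icc a b, (-f) x ≤ 0 :=
      image_le_of_deriv_right_lt_deriv_boundary' (f' := -f')
        (fun x hx => (hf x hx).neg.continuousWithinAt)
        (fun x hx => (hf x (Ico_subset_Icc_self hx)).neg.mono_of_mem_nhdsWithin
          (Icc_mem_nhdsGE_of_mem hx))
        (neg_nonpos.2 ha) continuousOn_const (fun x _ => hasDerivWithinAt_const x _ 0)
        (fun x hx h => neg_neg_of_pos (hpos x (Ico_subset_Icc_self hx) (neg_eq_zero.1 h)))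
    exact fun x hx => neg_nonpos.1 (hneg x hx)
  refine (hnonneg b hb).lt_of_ne' fun hzero => ?_
  have hmin : IsLocalMinOn f (Icc a b) b :=
    eventually_of_mem self_mem_nhdsWithin fun y hy => hzero.trans_le (hnonneg y hy)
  have hdir : a - b ∈ posTangentConeAt (Icc a b) b :=
    mem_posTangentConeAt_of_segment_subset
      (by rw [add_sub_cancel, segment_symm, segment_eq_Icc hab.le])
  have hle : 0 ≤ (a - b) * f' b := by
    simpa using hmin.hasFDerivWithinAt_nonneg (hf b hb).hasFDerivWithinAt hdir
  exact hle.not_gt (mul_neg_of_neg_of_pos (sub_neg.2 hab) (hpos b hb hzero))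

lemma ne_zero_of_periodic_of_deriv_pos {f f' : ℝ → ℝ} {c : ℝ} (hc : 0 < c)
    (hper : Function.Periodic f c) (hf : ∀ x, HasDerivAt f (f' x) x)
    (hpos : ∀ x, f x = 0 → 0 < f' x) (x : ℝ) : f x ≠ 0 := fun hzero =>
  (pos_of_deriv_pos_of_eq_zero (lt_add_of_pos_right x hc) (fun y _ => (hf y).hasDerivWithinAt)
    (fun y _ => hpos y) hzero.ge).ne' ((hper x).trans hzero)

lemma exists_isLocalExtr_forall_abs_le {f : ℝ → ℝ} {c : ℝ} (hc : c ≠ 0) (hf : Continuous f)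
    (hper : Function.Periodic f c) : ∃ m, IsLocalExtr f m ∧ ∀ x, |f x| ≤ |f m| := by
  have hcompact : IsCompact (range fun x => |f x|) :=
    Function.Periodic.compact_of_continuous (fun x => congrArg abs (hper x)) hc hf.abs
  obtain ⟨_, ⟨m, rfl⟩, hm⟩ := hcompact.exists_isGreatest (range_nonempty _)
  have hm' : ∀ x, |f x| ≤ |f m| := fun x => hm (mem_range_self x)
  refine ⟨m, ?_, hm'⟩
  rcases le_total 0 (f m) with h | h
  · exact Or.inr (.of_forall fun x => (abs_of_nonneg h) ▸ (le_abs_self _).trans (hm' x))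
  · exact Or.inl (.of_forall fun x => neg_le_neg_iff.1
      ((abs_of_nonpos h) ▸ (neg_le_abs _).trans (hm' x)))

lemma periodic_deriv {f : ℝ → ℝ} {c : ℝ} (hf : Function.Periodic f c) :
    Function.Periodic (deriv f) c := fun x => by
  rw [← deriv_comp_add_const, funext hf]

lemma periodic_primitive {E : Type*} [NormedAddCommGroup E] [NormedSpace ℝ E] {f : ℝ → E} {c : ℝ}
    (hf : Continuous f) (hper : Function.Periodic f c) (hmean : ∫ x in 0..c, f x = 0) :
    Function.Periodic (fun x => ∫ y in 0..x, f y) c := by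
  intro x
  have hcell := hper.intervalIntegral_add_eq x 0
  rw [zero_add, hmean] at hcell
  simp only
  rw [← intervalIntegral.integral_add_adjacent_intervals (hf.intervalIntegrable 0 x)
    (hf.intervalIntegrable x (x + c)), hcell, add_zero]

lemma exists_eq_zero_of_integral_eq_zero {f : ℝ → ℝ} {a b : ℝ} (hab : a ≠ b) (hf : Continuous f)
    (h : ∫ x in a..b, f x = 0) : ∃ x, f x = 0 := by
  obtain ⟨x, -, hx⟩ := exists_eq_interval_average hab hf.continuousOn
  exact ⟨x, by rw [hx, interval_average_eq, h, smul_zero]⟩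

lemma exists_forall_abs_le_of_periodic {f : ℝ → ℝ} {c : ℝ} (hc : c ≠ 0) (hf : Continuous f)
    (hper : Function.Periodic f c) : ∃ C, ∀ x, |f x| ≤ C :=
  let ⟨m, _, hm⟩ := exists_isLocalExtr_forall_abs_le hc hf hper
  ⟨|f m|, hm⟩

lemma one_le_sqrt_one_add_sq (a : ℝ) : 1 ≤ √(1 + a ^ 2) :=
  Real.one_le_sqrt.2 (le_add_of_nonneg_right (sq_nonneg a))

lemma abs_le_sqrt_one_add_sq (a : ℝ) : |a| ≤ √(1 + a ^ 2) :=
  Real.abs_le_sqrt (le_add_of_nonneg_left zero_le_one)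

lemma sqrt_one_add_sq_le_sqrt {a b : ℝ} (h : |a| ≤ |b|) : √(1 + a ^ 2) ≤ √(1 + b ^ 2) :=
  Real.sqrt_le_sqrt (add_le_add_right (sq_le_sq.2 h) 1)

/-- The cell problem solved for `w''`: with `y = μ + w'` and `s` the value of `v`, it reads
`y' = profileField d H s y`. -/
noncomputable def profileField (d H s y : ℝ) : ℝ := (1 + y ^ 2) * (√(1 + y ^ 2) + s - H) / d

section profileField

variable {d H s y : ℝ}

lemma profileField_pos_iff (hd : 0 < d) : 0 < profileField d H s y ↔ H < √(1 + y ^ 2) + s := by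
  rw [profileField, div_pos_iff_of_pos_right hd, mul_pos_iff_of_pos_left (by positivity), sub_pos]

lemma profileField_neg_iff (hd : 0 < d) : profileField d H s y < 0 ↔ √(1 + y ^ 2) + s < H := by
  rw [profileField, div_lt_iff₀ hd, zero_mul, ← neg_pos, ← mul_neg,
    mul_pos_iff_of_pos_left (by positivity), neg_pos, sub_neg]

lemma profileField_eq_zero_iff (hd : 0 < d) : profileField d H s y = 0 ↔ √(1 + y ^ 2) + s = H := by
  have : 1 + y ^ 2 ≠ 0 := by positivity
  simp [profileField, this, hd.ne', sub_eq_zero]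

lemma profileField_lt_profileField {H' : ℝ} (hd : 0 < d) (hH : H < H') :
    profileField d H' s y < profileField d H s y := by
  unfold profileField
  gcongr

lemma contDiff_profileField (d : ℝ) :
    ContDiff ℝ 1 (fun p : ℝ × ℝ × ℝ => profileField d p.1 p.2.1 p.2.2) := by
  have : ContDiff ℝ 1 (fun p : ℝ × ℝ × ℝ => √(1 + p.2.2 ^ 2)) :=
    ContDiff.sqrt (by fun_prop) fun p => by positivity
  unfold profileField
  fun_prop

lemma exists_lipschitzOnWith_profileField (d L V R : ℝ) :
    ∃ K, LipschitzOnWith K (fun p : ℝ × ℝ × ℝ => profileField d p.1 p.2.1 p.2.2)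
      (Icc (-L) L ×ˢ Icc (-V) V ×ˢ Icc (-R) R) :=
  LocallyLipschitzOn.exists_lipschitzOnWith_of_compact
    (isCompact_Icc.prod (isCompact_Icc.prod isCompact_Icc))
    (contDiff_profileField d).locallyLipschitz.locallyLipschitzOn

end profileField

/-- The slope `u = μ + w'` of a cell solution, characterized by a first order equation. -/
structure IsProfile (v : ℝ → ℝ) (μ d H : ℝ) (u : ℝ → ℝ) : Prop where
  periodic : Function.Periodic u 1
  hasDerivAt : ∀ x, HasDerivAt u (profileField d H (v x) (u x)) x
  mean : ∫ x in (0 : ℝ)..1, u x = μ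

namespace IsProfile

variable {v : ℝ → ℝ} {μ d H : ℝ} {u : ℝ → ℝ}

lemma continuous (hu : IsProfile v μ d H u) : Continuous u :=
  continuous_iff_continuousAt.2 fun x => (hu.hasDerivAt x).continuousAt

lemma integral_sub_mean (hu : IsProfile v μ d H u) : ∫ x in (0 : ℝ)..1, (u x - μ) = 0 := by
  rw [intervalIntegral.integral_sub (hu.continuous.intervalIntegrable _ _) (by simp), hu.mean]
  simp

lemma exists_eq_mean (hu : IsProfile v μ d H u) : ∃ x, u x = μ := by
  obtain ⟨x, hx⟩ := exists_eq_zero_of_integral_eq_zero zero_ne_one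
    (hu.continuous.sub continuous_const) hu.integral_sub_mean
  exact ⟨x, sub_eq_zero.1 hx⟩

lemma ne_const (hd : 0 < d) (hu : IsProfile v μ d H u) {c : ℝ}
    (hc : ∀ x, √(1 + c ^ 2) + v x < H) (x : ℝ) : u x ≠ c := by
  refine (sub_ne_zero.1 (ne_zero_of_periodic_of_deriv_pos (f := fun x => c - u x) one_pos
    (fun x => congrArg (c - ·) (hu.periodic x)) (fun x => (hu.hasDerivAt x).const_sub c)
    (fun x hx => ?_) x)).symm
  rw [← sub_eq_zero.1 hx]
  exact neg_pos.2 ((profileField_neg_iff hd).2 (hc x))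

lemma level_le_sqrt (hd : 0 < d) (hv : ∀ x, v x ≤ 0) (hu : IsProfile v μ d H u) :
    H ≤ √(1 + μ ^ 2) := by
  obtain ⟨x, hx⟩ := hu.exists_eq_mean
  by_contra! hlt
  exact hu.ne_const hd (fun y => by linarith [hv y]) x hx

lemma ne_zero (hd : 0 < d) (hv : ∀ x, v x ≤ 0) (hu : IsProfile v μ d H u) (hH : 1 < H) (x : ℝ) :
    u x ≠ 0 :=
  hu.ne_const hd (fun y => by norm_num; linarith [hv y]) x

lemma sqrt_one_add_sq_le (hd : 0 < d) (hu : IsProfile v μ d H u) {V : ℝ} (hV : ∀ x, -V ≤ v x)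
    (x : ℝ) : √(1 + u x ^ 2) ≤ H + V := by
  obtain ⟨m, hm, hmax⟩ := exists_isLocalExtr_forall_abs_le one_ne_zero hu.continuous hu.periodic
  have hcrit : √(1 + u m ^ 2) + v m = H :=
    (profileField_eq_zero_iff hd).1 (hm.hasDerivAt_eq_zero (hu.hasDerivAt m))
  linarith [sqrt_one_add_sq_le_sqrt (hmax x), hV m]

lemma level_le_of_eq {μ' H' : ℝ} {u' : ℝ → ℝ} (hd : 0 < d) (hu : IsProfile v μ d H u)
    (hu' : IsProfile v μ' d H' u') {x : ℝ} (hx : u x = u' x) : H' ≤ H := by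
  by_contra! hlt
  refine ne_zero_of_periodic_of_deriv_pos (f := u - u') one_pos (hu.periodic.sub hu'.periodic)
    (fun x => (hu.hasDerivAt x).sub (hu'.hasDerivAt x)) (fun x hx => ?_) x (sub_eq_zero.2 hx)
  rw [sub_eq_zero.1 hx]
  exact sub_pos.2 (profileField_lt_profileField hd hlt)

lemma eq_of_apply_eq {μ' : ℝ} {u' : ℝ → ℝ} (hv : Continuous v) (hper : Function.Periodic v 1)
    (hu : IsProfile v μ d H u) (hu' : IsProfile v μ' d H u') {x : ℝ} (hx : u x = u' x) :
    u = u' := by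
  obtain ⟨A, hA⟩ := exists_forall_abs_le_of_periodic one_ne_zero hu.continuous hu.periodic
  obtain ⟨B, hB⟩ := exists_forall_abs_le_of_periodic one_ne_zero hu'.continuous hu'.periodic
  obtain ⟨V, hV⟩ := exists_forall_abs_le_of_periodic one_ne_zero hv hper
  obtain ⟨K, hK⟩ := exists_lipschitzOnWith_profileField d |H| V (max A B)
  have hlip : ∀ t, LipschitzOnWith K (profileField d H (v t)) (Icc (-max A B) (max A B)) := by
    intro t y hy z hz
    have hH : H ∈ Icc (-|H|) |H| := abs_le.1 le_rfl
    simpa [Prod.edist_eq] using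
      hK (x := (H, v t, y)) ⟨hH, abs_le.1 (hV t), hy⟩ (y := (H, v t, z)) ⟨hH, abs_le.1 (hV t), hz⟩
  exact ODE_solution_unique_univ hlip
    (fun t => ⟨hu.hasDerivAt t, abs_le.1 ((hA t).trans (le_max_left A B))⟩)
    (fun t => ⟨hu'.hasDerivAt t, abs_le.1 ((hB t).trans (le_max_right A B))⟩) hx

theorem unique {H' : ℝ} {u' : ℝ → ℝ} (hd : 0 < d) (hv : Continuous v)
    (hper : Function.Periodic v 1) (hu : IsProfile v μ d H u) (hu' : IsProfile v μ d H' u') :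
    H = H' ∧ u = u' := by
  have hmean : ∫ x in (0 : ℝ)..1, (u x - u' x) = 0 := by
    rw [intervalIntegral.integral_sub (hu.continuous.intervalIntegrable _ _)
      (hu'.continuous.intervalIntegrable _ _), hu.mean, hu'.mean, sub_self]
  obtain ⟨x, hx⟩ := exists_eq_zero_of_integral_eq_zero zero_ne_one
    (hu.continuous.sub hu'.continuous) hmean
  have hx : u x = u' x := sub_eq_zero.1 hx
  obtain rfl : H = H' :=
    le_antisymm (hu'.level_le_of_eq hd hu hx.symm) (hu.level_le_of_eq hd hu' hx)
  exact ⟨rfl, hu.eq_of_apply_eq hv hper hu' hx⟩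

lemma hasDerivAt_energy (hu : IsProfile v μ d H u) {v' x : ℝ} (hv : HasDerivAt v v' x) :
    HasDerivAt (fun x => (∫ t in (0 : ℝ)..u x, √(1 + t ^ 2)) - H * u x + u x * v x)
      ((1 + u x ^ 2) * (√(1 + u x ^ 2) + v x - H) ^ 2 / d + u x * v') x := by
  have harea : HasDerivAt (fun y => ∫ t in (0 : ℝ)..y, √(1 + t ^ 2)) √(1 + u x ^ 2) (u x) :=
    (Continuous.integral_hasStrictDerivAt (by fun_prop) 0 (u x)).hasDerivAt
  have hux := hu.hasDerivAt x
  refine (((harea.comp x hux).sub (hux.const_mul H)).add (hux.mul hv)).congr_deriv ?_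
  rw [profileField]
  ring

lemma integral_residual_sq_le (hd : 0 < d) (hv : ContDiff ℝ 1 v) (hper : Function.Periodic v 1)
    (hu : IsProfile v μ d H u) {M : ℝ} (hM : ∀ x, |u x * deriv v x| ≤ M) :
    ∫ x in (0 : ℝ)..1, (√(1 + u x ^ 2) + v x - H) ^ 2 ≤ d * M := by
  set r : ℝ → ℝ := fun x => √(1 + u x ^ 2) + v x - H
  have huc := hu.continuous
  have hvc := hv.continuous
  have := hv.continuous_deriv le_rfl
  have hr : Continuous r := by fun_prop
  have henergy : ∫ x in (0 : ℝ)..1, ((1 + u x ^ 2) * r x ^ 2 / d + u x * deriv v x) = 0 := by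
    rw [intervalIntegral.integral_eq_sub_of_hasDerivAt
      (fun x _ => hu.hasDerivAt_energy (hv.differentiable one_ne_zero x).hasDerivAt)
      (Continuous.intervalIntegrable (by fun_prop) _ _)]
    simp [hu.periodic.eq, hper.eq]
  have hle : ∀ x, r x ^ 2 ≤ d * ((1 + u x ^ 2) * r x ^ 2 / d + u x * deriv v x) + d * M := by
    intro x
    have hcancel : d * ((1 + u x ^ 2) * r x ^ 2 / d) = (1 + u x ^ 2) * r x ^ 2 := by
      field_simp
    nlinarith [neg_le_of_abs_le (hM x), mul_nonneg (sq_nonneg (u x)) (sq_nonneg (r x))]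
  calc ∫ x in (0 : ℝ)..1, r x ^ 2
      ≤ ∫ x in (0 : ℝ)..1, (d * ((1 + u x ^ 2) * r x ^ 2 / d + u x * deriv v x) + d * M) :=
        intervalIntegral.integral_mono zero_le_one
          (Continuous.intervalIntegrable (by fun_prop) _ _)
          (Continuous.intervalIntegrable (by fun_prop) _ _) hle
    _ = d * M := by
        rw [intervalIntegral.integral_add (Continuous.intervalIntegrable (by fun_prop) _ _)
          (by simp), intervalIntegral.integral_const_mul, henergy]
        simp

end IsProfile

section CellProblem

variable {v : ℝ → ℝ} {μ d H : ℝ}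

lemma IsCellSolution.isProfile {w : ℝ → ℝ} (hd : 0 < d) (hw : IsCellSolution v μ d H w) :
    IsProfile v μ d H (fun x => μ + deriv w x) where
  periodic x := congrArg (μ + ·) (periodic_deriv hw.periodic x)
  hasDerivAt x := by
    have : (0 : ℝ) < 1 + (μ + deriv w x) ^ 2 := by positivity
    refine ((hw.contDiff.differentiable_deriv_two x).hasDerivAt.const_add μ).congr_deriv ?_
    rw [profileField, ← hw.equation x]
    field_simp
    ring
  mean := by
    have hc : Continuous (deriv w) := hw.contDiff.continuous_deriv one_le_two
    have hzero : ∫ x in (0 : ℝ)..1, deriv w x = 0 := by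
      rw [intervalIntegral.integral_deriv_eq_sub' w rfl
        (fun x _ => hw.contDiff.differentiable two_ne_zero x) hc.continuousOn]
      simp [hw.periodic.eq]
    rw [intervalIntegral.integral_add (by simp) (hc.intervalIntegrable _ _), hzero]
    simp

lemma IsProfile.isCellSolution {u : ℝ → ℝ} (hd : 0 < d) (hv : Continuous v)
    (hu : IsProfile v μ d H u) :
    IsCellSolution v μ d H (fun x => ∫ y in (0 : ℝ)..x, (u y - μ)) := by
  have huc := hu.continuous
  have hu' : ∀ x, HasDerivAt (fun x => u x - μ) (profileField d H (v x) (u x)) x :=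
    fun x => (hu.hasDerivAt x).sub_const μ
  have hw' : ∀ x, HasDerivAt (fun x => ∫ y in (0 : ℝ)..x, (u y - μ)) (u x - μ) x :=
    fun x => (Continuous.integral_hasStrictDerivAt (by fun_prop) 0 x).hasDerivAt
  have hderiv : deriv (fun x => ∫ y in (0 : ℝ)..x, (u y - μ)) = fun x => u x - μ :=
    deriv_eq hw'
  have hderiv' : deriv (fun x => u x - μ) = fun x => profileField d H (v x) (u x) :=
    deriv_eq hu'
  refine ⟨?_, ?_, by simp, fun y => ?_⟩
  · rw [← one_add_one_eq_two, contDiff_succ_iff_deriv, hderiv, contDiff_one_iff_deriv, hderiv']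
    exact ⟨fun x => (hw' x).differentiableAt, by simp, fun x => (hu' x).differentiableAt,
      (contDiff_profileField d).continuous.comp (by fun_prop : Continuous fun x => (H, v x, u x))⟩
  · exact periodic_primitive (by fun_prop) (hu.periodic.sub fun _ => rfl) hu.integral_sub_mean
  · have : (0 : ℝ) < 1 + u y ^ 2 := by positivity
    simp only [hderiv, hderiv', profileField, add_sub_cancel]
    field_simp
    ring

end CellProblem

/-- Truncation to `[-r, r]`, which makes the profile equation globally Lipschitz. -/
noncomputable def clip (r x : ℝ) : ℝ := max (-r) (min r x)

lemma clip_mem_Icc {r : ℝ} (hr : 0 ≤ r) (x : ℝ) : clip r x ∈ Icc (-r) r :=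
  ⟨le_max_left _ _, max_le (by linarith) (min_le_left _ _)⟩

lemma clip_of_abs_le {r x : ℝ} (h : |x| ≤ r) : clip r x = x := by
  rw [clip, min_eq_right (abs_le.1 h).2, max_eq_right (abs_le.1 h).1]

lemma abs_lt_of_abs_clip_lt {r x : ℝ} (h : |clip r x| < r) : |x| < r := by
  grind [clip]

lemma lipschitzWith_clip (r : ℝ) : LipschitzWith 1 (clip r) :=
  (LipschitzWith.id.const_min r).const_max (-r)

lemma exists_periodic_extension {E : Type*} [NormedAddCommGroup E] [NormedSpace ℝ E]
    [CompleteSpace E] {F : ℝ → E → E} (hF : Continuous (Function.uncurry F))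
    (hper : Function.Periodic F 1) {U : ℝ → E} (hends : U 0 = U 1)
    (hU : ∀ t ∈ Icc (0 : ℝ) 1, HasDerivWithinAt U (F t (U t)) (Icc 0 1) t) :
    ∃ u : ℝ → E, Function.Periodic u 1 ∧ (∀ t, HasDerivAt u (F t (u t)) t) ∧
      EqOn u U (Icc 0 1) := by
  have hUc : ContinuousOn U (Icc 0 1) := fun t ht => (hU t ht).continuousWithinAt
  set u : ℝ → E := U ∘ Int.fract
  have huper : Function.Periodic u 1 := fun t => by simp [u]
  have huU : EqOn u U (Icc 0 1) := by
    intro t ht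
    rcases ht.2.eq_or_lt with rfl | hlt
    · simp [u, hends]
    · simp [u, Int.fract_eq_self.2 ⟨ht.1, hlt⟩]
  set g : ℝ → E := fun t => F t (u t) with hg
  have hgc : Continuous g := hF.comp (continuous_id.prodMk (hUc.comp_fract'' hends))
  have hgper : Function.Periodic g 1 := fun t => by simp only [hg, huper t, hper t]
  have hI : ∀ t, HasDerivAt (fun t => U 0 + ∫ s in 0..t, g s) (g t) t := fun t =>
    (hgc.integral_hasStrictDerivAt 0 t).hasDerivAt.const_add _
  have hIU : EqOn (fun t => U 0 + ∫ s in 0..t, g s) U (Icc 0 1) := by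
    refine eq_of_has_deriv_right_eq (f' := g) (fun t _ => (hI t).hasDerivWithinAt)
      (fun t ht => ?_) (fun t _ => (hI t).continuousAt.continuousWithinAt) hUc (by simp)
    simpa only [hg, huU (Ico_subset_Icc_self ht)] using
      (hU t (Ico_subset_Icc_self ht)).mono_of_mem_nhdsWithin (Icc_mem_nhdsGE_of_mem ht)
  have hmean : ∫ s in 0..1, g s = 0 := by
    simpa [← hends] using hIU (right_mem_Icc.2 zero_le_one)
  have hIu : (fun t => U 0 + ∫ s in 0..t, g s) = u := by
    ext t
    have hdiff : Function.Periodic (fun t => U 0 + (∫ s in 0..t, g s) - u t) 1 := fun t => by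
      simp only [periodic_primitive hgc hgper hmean t, huper t]
    obtain ⟨z, hz, htz⟩ := hdiff.exists_mem_Ico₀ one_pos t
    rw [← sub_eq_zero, htz, sub_eq_zero, huU (Ico_subset_Icc_self hz)]
    exact hIU (Ico_subset_Icc_self hz)
  refine ⟨u, huper, fun t => ?_, huU⟩
  simpa only [hIu] using hI t

open scoped NNReal in
lemma exists_flow_of_bounded {E : Type*} [NormedAddCommGroup E] [NormedSpace ℝ E]
    [CompleteSpace E] {f : ℝ → E → E} {K L : ℝ≥0} (hlip : ∀ t, LipschitzWith K (f t))
    (hcont : ∀ x, Continuous fun t => f t x) (hbound : ∀ t x, ‖f t x‖ ≤ L) (r : ℝ≥0) :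
    ∃ α : E → ℝ → E,
      (∀ x ∈ Metric.closedBall 0 r, α x 0 = x ∧
        ∀ t ∈ Icc (0 : ℝ) 1, HasDerivWithinAt (α x) (f t (α x t)) (Icc 0 1) t) ∧
      ∀ t ∈ Icc (0 : ℝ) 1, ContinuousOn (fun x => α x t) (Metric.closedBall 0 r) := by
  have hPL : IsPicardLindelof f (tmin := 0) (tmax := 1) ⟨0, by simp⟩ (0 : E) (r + L) r L K :=
    ⟨fun t _ => (hlip t).lipschitzOnWith, fun x _ => (hcont x).continuousOn,
      fun t _ x _ => hbound t x, by simp⟩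
  obtain ⟨α, hα, hαc⟩ := hPL.exists_forall_mem_closedBall_eq_hasDerivWithinAt_continuousOn
  exact ⟨fun x t => α (x, t), hα,
    fun t ht => hαc.comp (by fun_prop) fun x hx => ⟨hx, ht⟩⟩

/-- `U (a, H)` solves the profile equation at level `H`, truncated at `R`, with initial value `a`
on `[0, 1]`, and `W (a, H)` is its running integral; both end values depend continuously on
`(a, H)`. -/
structure IsShootingFlow (v : ℝ → ℝ) (d R : ℝ) (U W : ℝ × ℝ → ℝ → ℝ) : Prop where
  apply_zero : ∀ p ∈ Icc (-R) R ×ˢ Icc (-R) R, U p 0 = p.1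
  integral_zero : ∀ p ∈ Icc (-R) R ×ˢ Icc (-R) R, W p 0 = 0
  hasDerivWithinAt : ∀ p ∈ Icc (-R) R ×ˢ Icc (-R) R, ∀ t ∈ Icc (0 : ℝ) 1,
    HasDerivWithinAt (U p) (profileField d p.2 (v t) (clip R (U p t))) (Icc 0 1) t
  integral_hasDerivWithinAt : ∀ p ∈ Icc (-R) R ×ˢ Icc (-R) R, ∀ t ∈ Icc (0 : ℝ) 1,
    HasDerivWithinAt (W p) (clip R (U p t)) (Icc 0 1) t
  continuousOn : ContinuousOn (fun p => U p 1) (Icc (-R) R ×ˢ Icc (-R) R)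
  integral_continuousOn : ContinuousOn (fun p => W p 1) (Icc (-R) R ×ˢ Icc (-R) R)

lemma exists_lipschitz_bounded_shootingField {v : ℝ → ℝ} (d : ℝ) {V R : ℝ}
    (hV : ∀ x, |v x| ≤ V) (hR : 0 ≤ R) : ∃ K L : NNReal,
      (∀ t, LipschitzWith K fun q : ℝ × ℝ × ℝ =>
        (profileField d (clip R q.2.2) (v t) (clip R q.1), clip R q.1, (0 : ℝ))) ∧
      ∀ t (q : ℝ × ℝ × ℝ),
        ‖(profileField d (clip R q.2.2) (v t) (clip R q.1), clip R q.1, (0 : ℝ))‖ ≤ L := by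
  obtain ⟨K, hK⟩ := exists_lipschitzOnWith_profileField d R V R
  obtain ⟨L, hL⟩ := (isCompact_Icc.prod (isCompact_Icc.prod isCompact_Icc) :
    IsCompact (Icc (-R) R ×ˢ Icc (-V) V ×ˢ Icc (-R) R)).exists_bound_of_continuousOn
      (contDiff_profileField d).continuous.continuousOn
  have hmem : ∀ t (q : ℝ × ℝ × ℝ),
      (clip R q.2.2, v t, clip R q.1) ∈ Icc (-R) R ×ˢ Icc (-V) V ×ˢ Icc (-R) R :=
    fun t q => ⟨clip_mem_Icc hR _, abs_le.1 (hV t), clip_mem_Icc hR _⟩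
  have hfst : LipschitzWith (1 * 1) fun q : ℝ × ℝ × ℝ => clip R q.1 :=
    (lipschitzWith_clip R).comp LipschitzWith.prod_fst
  have hlevel : LipschitzWith (1 * (1 * 1)) fun q : ℝ × ℝ × ℝ => clip R q.2.2 :=
    (lipschitzWith_clip R).comp (LipschitzWith.prod_snd.comp LipschitzWith.prod_snd)
  refine ⟨_, (max L R).toNNReal, fun t => LipschitzWith.prodMk (lipschitzOnWith_univ.1
    (hK.comp (hlevel.prodMk ((LipschitzWith.const (v t)).prodMk hfst)).lipschitzOnWith
      fun q _ => hmem t q)) (hfst.prodMk (LipschitzWith.const 0)), fun t q => ?_⟩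
  refine le_trans ?_ (Real.le_coe_toNNReal _)
  exact norm_prod_le_iff.2 ⟨(hL _ (hmem t q)).trans (le_max_left _ _),
    norm_prod_le_iff.2 ⟨(abs_le.2 (clip_mem_Icc hR _)).trans (le_max_right _ _),
      by simpa using hR.trans (le_max_right _ _)⟩⟩

lemma exists_isShootingFlow {v : ℝ → ℝ} (hv : Continuous v) (d : ℝ) {V R : ℝ}
    (hV : ∀ x, |v x| ≤ V) (hR : 0 ≤ R) : ∃ U W, IsShootingFlow v d R U W := by
  obtain ⟨K, L, hlip, hbound⟩ := exists_lipschitz_bounded_shootingField d hV hR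
  have hcont : ∀ q : ℝ × ℝ × ℝ, Continuous fun t =>
      (profileField d (clip R q.2.2) (v t) (clip R q.1), clip R q.1, (0 : ℝ)) := fun q =>
    ((contDiff_profileField d).continuous.comp
      (by fun_prop : Continuous fun t => (clip R q.2.2, v t, clip R q.1))).prodMk continuous_const
  -- The level `H` is carried along as a constant third component of the state.
  obtain ⟨α, hα, hαc⟩ := exists_flow_of_bounded hlip hcont hbound ⟨R, hR⟩
  have hball : ∀ p ∈ Icc (-R) R ×ˢ Icc (-R) R,
      ((p.1, 0, p.2) : ℝ × ℝ × ℝ) ∈ Metric.closedBall 0 R := fun p hp =>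
    mem_closedBall_zero_iff.2 (norm_prod_le_iff.2 ⟨abs_le.2 hp.1,
      norm_prod_le_iff.2 ⟨by simpa using hR, abs_le.2 hp.2⟩⟩)
  have hcont_one : ContinuousOn (fun p : ℝ × ℝ => α (p.1, 0, p.2) 1) (Icc (-R) R ×ˢ Icc (-R) R) :=
    (hαc 1 (by simp)).comp (by fun_prop) hball
  have hlevel : ∀ p ∈ Icc (-R) R ×ˢ Icc (-R) R, ∀ t ∈ Icc (0 : ℝ) 1,
      (α (p.1, 0, p.2) t).2.2 = p.2 := by
    intro p hp t ht
    obtain ⟨hzero, hderiv⟩ := hα _ (hball p hp)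
    rw [constant_of_has_deriv_right_zero (fun t ht => (hderiv t ht).continuousWithinAt.snd.snd)
      (fun t ht => ((hderiv t (Ico_subset_Icc_self ht)).mono_of_mem_nhdsWithin
        (Icc_mem_nhdsGE_of_mem ht)).snd.snd) t ht, hzero]
  refine ⟨fun p t => (α (p.1, 0, p.2) t).1, fun p t => (α (p.1, 0, p.2) t).2.1,
    fun p hp => ?_, fun p hp => ?_, fun p hp t ht => ?_,
    fun p hp t ht => ((hα _ (hball p hp)).2 t ht).snd.fst, hcont_one.fst, hcont_one.snd.fst⟩
  · rw [(hα _ (hball p hp)).1]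
  · rw [(hα _ (hball p hp)).1]
  · have hderiv := ((hα _ (hball p hp)).2 t ht).fst
    rwa [hlevel p hp t ht, clip_of_abs_le (abs_le.2 hp.2)] at hderiv

lemma isProfile_of_truncated {v : ℝ → ℝ} {d H R V : ℝ} (hd : 0 < d) (hV : ∀ x, -V ≤ v x)
    (hR : H + V < R) {u : ℝ → ℝ} (hper : Function.Periodic u 1)
    (hu : ∀ t, HasDerivAt u (profileField d H (v t) (clip R (u t))) t) :
    IsProfile v (∫ x in (0 : ℝ)..1, u x) d H u ∧ ∀ t, |u t| ≤ R := by
  have huc : Continuous u := continuous_iff_continuousAt.2 fun x => (hu x).continuousAt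
  obtain ⟨m, hm, hmax⟩ := exists_isLocalExtr_forall_abs_le one_ne_zero huc hper
  have hcrit : √(1 + clip R (u m) ^ 2) + v m = H :=
    (profileField_eq_zero_iff hd).1 (hm.hasDerivAt_eq_zero (hu m))
  have hlt : |u m| < R := abs_lt_of_abs_clip_lt
    (by linarith [abs_le_sqrt_one_add_sq (clip R (u m)), hV m])
  have hbound : ∀ t, |u t| ≤ R := fun t => (hmax t).trans hlt.le
  exact ⟨⟨hper, fun t => by simpa only [clip_of_abs_le (hbound t)] using hu t, rfl⟩, hbound⟩

namespace IsShootingFlow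

variable {v : ℝ → ℝ} {d R V : ℝ} {U W : ℝ × ℝ → ℝ → ℝ}

lemma exists_isProfile (hUW : IsShootingFlow v d R U W) (hd : 0 < d) (hv : Continuous v)
    (hper : Function.Periodic v 1) (hV : ∀ x, -V ≤ v x) {p : ℝ × ℝ}
    (hp : p ∈ Icc (-R) R ×ˢ Icc (-R) R) (hR : p.2 + V < R) (hends : U p 1 = p.1) :
    ∃ u, IsProfile v (W p 1) d p.2 u ∧ u 0 = p.1 := by
  have hfield : Continuous (Function.uncurry fun t y => profileField d p.2 (v t) (clip R y)) :=
    (contDiff_profileField d).continuous.comp (f := fun q : ℝ × ℝ => (p.2, v q.1, clip R q.2))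
      (continuous_const.prodMk ((hv.comp continuous_fst).prodMk
        ((lipschitzWith_clip R).continuous.comp continuous_snd)))
  obtain ⟨u, huper, hu, huU⟩ := exists_periodic_extension hfield
    (fun t => by simp only [hper t]) ((hUW.apply_zero p hp).trans hends.symm)
    (hUW.hasDerivWithinAt p hp)
  obtain ⟨hprofile, hbound⟩ := isProfile_of_truncated hd hV hR huper hu
  have hmean : ∫ x in (0 : ℝ)..1, u x = W p 1 := by
    rw [intervalIntegral.integral_eq_sub_of_hasDerivAt_of_le (f := W p) zero_le_one
      (fun t ht => (hUW.integral_hasDerivWithinAt p hp t ht).continuousWithinAt) (fun t ht => ?_)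
      (hprofile.continuous.intervalIntegrable _ _), hUW.integral_zero p hp, sub_zero]
    have ht' := Ioo_subset_Icc_self ht
    have := (hUW.integral_hasDerivWithinAt p hp t ht').hasDerivAt (Icc_mem_nhds ht.1 ht.2)
    rwa [← huU ht', clip_of_abs_le (hbound t)] at this
  exact ⟨u, hmean ▸ hprofile, (huU (by simp)).trans (hUW.apply_zero p hp)⟩

lemma exists_level (hUW : IsShootingFlow v d R U W) (hd : 0 < d) (hV : ∀ x, |v x| ≤ V)
    {a B : ℝ} (ha : |a| ≤ R) (hB : √(1 + a ^ 2) + V < B) (hBR : B ≤ R) :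
    ∃ H ∈ Icc (-B) B, U (a, H) 1 = a := by
  have hV0 : 0 ≤ V := (abs_nonneg _).trans (hV 0)
  have hB0 : 0 < B := by linarith [Real.sqrt_nonneg (1 + a ^ 2)]
  have hbox : ∀ H ∈ Icc (-B) B, ((a, H) : ℝ × ℝ) ∈ Icc (-R) R ×ˢ Icc (-R) R :=
    fun H hH => ⟨abs_le.1 ha, Icc_subset_Icc (by linarith) hBR hH⟩
  have hcont : ContinuousOn (fun H => U (a, H) 1) (Icc (-B) B) :=
    hUW.continuousOn.comp (by fun_prop) hbox
  have hBmem : B ∈ Icc (-B) B := right_mem_Icc.2 (by linarith)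
  have hBmem' : -B ∈ Icc (-B) B := left_mem_Icc.2 (by linarith)
  have hle : U (a, B) 1 ≤ a := by
    refine (sub_pos.1 (pos_of_deriv_pos_of_eq_zero (f := fun t => a - U (a, B) t) zero_lt_one
      (fun t ht => (hUW.hasDerivWithinAt _ (hbox B hBmem) t ht).const_sub a)
      (fun t _ hzero => ?_) ?_)).le
    · rw [← sub_eq_zero.1 hzero, clip_of_abs_le ha, neg_pos, profileField_neg_iff hd]
      linarith [le_of_abs_le (hV t)]
    · rw [hUW.apply_zero _ (hbox B hBmem), sub_self]
  have hge : a ≤ U (a, -B) 1 := by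
    refine (sub_pos.1 (pos_of_deriv_pos_of_eq_zero (f := fun t => U (a, -B) t - a) zero_lt_one
      (fun t ht => (hUW.hasDerivWithinAt _ (hbox _ hBmem') t ht).sub_const a)
      (fun t _ hzero => ?_) ?_)).le
    · rw [sub_eq_zero.1 hzero, clip_of_abs_le ha, profileField_pos_iff hd]
      linarith [neg_le_of_abs_le (hV t), Real.sqrt_nonneg (1 + a ^ 2)]
    · rw [hUW.apply_zero _ (hbox _ hBmem'), sub_self]
  exact intermediate_value_Icc' (by linarith) hcont ⟨hle, hge⟩

end IsShootingFlow

lemma exists_fiber_le_le_of_isPreconnected {X Z : Type*} [TopologicalSpace X] [T2Space X]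
    [TopologicalSpace Z] {I : Set X} (hI : IsPreconnected I) {S : Set Z} (hS : IsCompact S)
    {π : Z → X} (hπ : ContinuousOn π S) {W : Z → ℝ} (hW : ContinuousOn W S) {μ : ℝ}
    (hsurj : I ⊆ π '' S) {p q : Z} (hp : p ∈ S) (hpI : π p ∈ I) (hpμ : W p ≤ μ) (hq : q ∈ S)
    (hqI : π q ∈ I) (hqμ : μ ≤ W q) : ∃ p ∈ S, ∃ q ∈ S, π p = π q ∧ W p ≤ μ ∧ μ ≤ W q := by
  have hclosed : ∀ T : Set ℝ, IsClosed T → IsClosed (π '' (S ∩ W ⁻¹' T)) := by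
    intro T hT
    have hcompact : IsCompact (S ∩ W ⁻¹' T) := by
      obtain ⟨C, hC, hWC⟩ := continuousOn_iff_isClosed.1 hW T hT
      rw [inter_comm, hWC]
      exact hS.inter_left hC
    exact (hcompact.image_of_continuousOn (hπ.mono inter_subset_left)).isClosed
  obtain ⟨-, -, ⟨p, ⟨hp, hpμ⟩, rfl⟩, q, ⟨hq, hqμ⟩, hpq⟩ :=
    isPreconnected_closed_iff.1 hI _ _ (hclosed (Iic μ) isClosed_Iic) (hclosed (Ici μ) isClosed_Ici)
      (fun x hx => by
        obtain ⟨z, hz, rfl⟩ := hsurj hx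
        exact (le_total (W z) μ).imp (fun h => ⟨z, ⟨hz, h⟩, rfl⟩) (fun h => ⟨z, ⟨hz, h⟩, rfl⟩))
      ⟨_, hpI, p, ⟨hp, hpμ⟩, rfl⟩ ⟨_, hqI, q, ⟨hq, hqμ⟩, rfl⟩
  exact ⟨p, hp, q, hq, hpq.symm, hpμ, hqμ⟩

namespace IsProfile

variable {v : ℝ → ℝ} {m d H V c : ℝ} {u : ℝ → ℝ}

lemma apply_ne_of_large (hd : 0 < d) (hV : ∀ x, |v x| ≤ V) (hu : IsProfile v m d H u) {y : ℝ}
    (hy : √(1 + c ^ 2) + 2 * V < √(1 + u y ^ 2)) (x : ℝ) : u x ≠ c := by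
  have hlevel := hu.sqrt_one_add_sq_le hd (fun x => neg_le_of_abs_le (hV x)) y
  exact hu.ne_const hd (fun z => by linarith [le_of_abs_le (hV z)]) x

lemma lt_mean_of_ne (hu : IsProfile v m d H u) (hne : ∀ x, u x ≠ c) {x : ℝ} (hx : c < u x) :
    c < m := by
  obtain ⟨y, hy⟩ := hu.exists_eq_mean
  by_contra! hle
  obtain ⟨z, hz⟩ :=
    mem_range_of_exists_le_of_exists_ge hu.continuous ⟨y, hy.trans_le hle⟩ ⟨x, hx.le⟩
  exact hne z hz

lemma mean_lt_of_ne (hu : IsProfile v m d H u) (hne : ∀ x, u x ≠ c) {x : ℝ} (hx : u x < c) :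
    m < c := by
  obtain ⟨y, hy⟩ := hu.exists_eq_mean
  by_contra! hle
  obtain ⟨z, hz⟩ :=
    mem_range_of_exists_le_of_exists_ge hu.continuous ⟨x, hx.le⟩ ⟨y, hle.trans hy.ge⟩
  exact hne z hz

end IsProfile

/-- Initial data `(a, H)` in the given box whose orbit closes up after one period. -/
def periodicData (U : ℝ × ℝ → ℝ → ℝ) (A B : ℝ) : Set (ℝ × ℝ) :=
  {p ∈ Icc (-A) A ×ˢ Icc (-B) B | U p 1 - p.1 = 0}

namespace IsShootingFlow

variable {v : ℝ → ℝ} {μ d A B R V : ℝ} {U W : ℝ × ℝ → ℝ → ℝ}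

lemma isCompact_periodicData (hUW : IsShootingFlow v d R U W) (hA : A ≤ R) (hB : B ≤ R) :
    IsCompact (periodicData U A B) ∧ ContinuousOn (fun p => W p 1) (periodicData U A B) := by
  have hbox : Icc (-A) A ×ˢ Icc (-B) B ⊆ Icc (-R) R ×ˢ Icc (-R) R :=
    prod_mono (Icc_subset_Icc (neg_le_neg hA) hA) (Icc_subset_Icc (neg_le_neg hB) hB)
  refine ⟨(isCompact_Icc.prod isCompact_Icc).of_isClosed_subset ?_ inter_subset_left,
    (hUW.integral_continuousOn.mono hbox).mono inter_subset_left⟩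
  exact ((hUW.continuousOn.mono hbox).sub continuousOn_fst).preimage_isClosed_of_isClosed
    (isClosed_Icc.prod isClosed_Icc) isClosed_singleton

/-- Orbits starting at `-A` and `A` have means on either side of `μ`, and the initial data of
periodic orbits project onto the connected interval `[-A, A]`. -/
lemma exists_mean_le_le (hUW : IsShootingFlow v d R U W) (hd : 0 < d) (hV : ∀ x, |v x| ≤ V)
    (hμA : |μ| < A) (hA : √(1 + μ ^ 2) + 2 * V < √(1 + A ^ 2)) (hAB : √(1 + A ^ 2) + V < B)
    (hBR : B ≤ R) (hprofile : ∀ p ∈ periodicData U A B,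
      ∃ u, IsProfile v (W p 1) d p.2 u ∧ u 0 = p.1) :
    ∃ p ∈ periodicData U A B, ∃ q ∈ periodicData U A B,
      p.1 = q.1 ∧ W p 1 ≤ μ ∧ μ ≤ W q 1 := by
  have hA0 : 0 < A := (abs_nonneg μ).trans_lt hμA
  have hAR : A ≤ R := by
    linarith [(le_abs_self A).trans (abs_le_sqrt_one_add_sq A), (abs_nonneg _).trans (hV 0)]
  have hsurj : ∀ a ∈ Icc (-A) A, ∃ H, (a, H) ∈ periodicData U A B := by
    intro a ha
    have haA : |a| ≤ |A| := (abs_le.2 ha).trans (le_abs_self A)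
    obtain ⟨H, hH, hUH⟩ := hUW.exists_level hd hV (a := a) (B := B)
      ((abs_le.2 ha).trans hAR) (by linarith [sqrt_one_add_sq_le_sqrt haA]) hBR
    exact ⟨H, ⟨ha, hH⟩, sub_eq_zero.2 hUH⟩
  obtain ⟨H₁, hH₁⟩ := hsurj (-A) ⟨le_rfl, by linarith⟩
  obtain ⟨H₂, hH₂⟩ := hsurj A ⟨by linarith, le_rfl⟩
  have hlow : W (-A, H₁) 1 ≤ μ := by
    obtain ⟨u, hu, hu0⟩ := hprofile _ hH₁
    exact (hu.mean_lt_of_ne (hu.apply_ne_of_large hd hV (y := 0) (by simpa [hu0] using hA))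
      (hu0.trans_lt (by linarith [neg_abs_le μ]))).le
  have hhigh : μ ≤ W (A, H₂) 1 := by
    obtain ⟨u, hu, hu0⟩ := hprofile _ hH₂
    exact (hu.lt_mean_of_ne (hu.apply_ne_of_large hd hV (y := 0) (by simpa [hu0] using hA))
      (((le_abs_self μ).trans_lt hμA).trans_eq hu0.symm)).le
  obtain ⟨hcompact, hcont⟩ := hUW.isCompact_periodicData hAR hBR
  exact exists_fiber_le_le_of_isPreconnected isPreconnected_Icc hcompact continuousOn_fst hcont
    (fun a ha => let ⟨H, hH⟩ := hsurj a ha; ⟨_, hH, rfl⟩) hH₁ hH₁.1.1 hlow hH₂ hH₂.1.1 hhigh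

end IsShootingFlow

theorem exists_isProfile {v : ℝ → ℝ} (hv : Continuous v) (hper : Function.Periodic v 1)
    (μ : ℝ) {d : ℝ} (hd : 0 < d) : ∃ H u, IsProfile v μ d H u := by
  obtain ⟨V, hV⟩ := exists_forall_abs_le_of_periodic one_ne_zero hv hper
  have hV0 : 0 ≤ V := (abs_nonneg _).trans (hV 0)
  obtain ⟨A, hμA, hA⟩ : ∃ A, |μ| < A ∧ √(1 + μ ^ 2) + 2 * V < √(1 + A ^ 2) := by
    refine ⟨√(1 + μ ^ 2) + 2 * V + 1, by linarith [abs_le_sqrt_one_add_sq μ], ?_⟩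
    exact (lt_add_one _).trans_le ((le_abs_self _).trans (abs_le_sqrt_one_add_sq _))
  have hA' : A ≤ √(1 + A ^ 2) := (le_abs_self A).trans (abs_le_sqrt_one_add_sq A)
  set B := √(1 + A ^ 2) + V + 1
  set R := B + V + 1
  obtain ⟨U, W, hUW⟩ := exists_isShootingFlow hv d hV
    (by linarith [Real.sqrt_nonneg (1 + A ^ 2)] : 0 ≤ R)
  have hprofile : ∀ p ∈ periodicData U A B, ∃ u, IsProfile v (W p 1) d p.2 u ∧ u 0 = p.1 :=
    fun p ⟨⟨ha, hH⟩, hends⟩ => hUW.exists_isProfile hd hv hper (fun x => neg_le_of_abs_le (hV x))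
      ⟨Icc_subset_Icc (by linarith) (by linarith) ha,
        Icc_subset_Icc (by linarith) (by linarith) hH⟩
      (by linarith [hH.2]) (sub_eq_zero.1 hends)
  obtain ⟨p, hp, q, hq, hpq, hpμ, hqμ⟩ :=
    hUW.exists_mean_le_le hd hV hμA hA (lt_add_one _) (by linarith) hprofile
  obtain ⟨u, hu, hu0⟩ := hprofile p hp
  obtain ⟨u', hu', hu'0⟩ := hprofile q hq
  have hmeet : u 0 = u' 0 := by rw [hu0, hpq, hu'0]
  have hlevel : p.2 = q.2 :=
    le_antisymm (hu'.level_le_of_eq hd hu hmeet.symm) (hu.level_le_of_eq hd hu' hmeet)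
  have hmean : W p 1 = μ := hpμ.antisymm (by rwa [Prod.ext hpq hlevel])
  exact ⟨p.2, u, hmean ▸ hu⟩

theorem existsUnique_isCellSolution {v : ℝ → ℝ} (hv : Continuous v) (hper : Function.Periodic v 1)
    (μ : ℝ) {d : ℝ} (hd : 0 < d) :
    ∃! Hw : ℝ × (ℝ → ℝ), IsCellSolution v μ d Hw.1 Hw.2 := by
  obtain ⟨H, u, hu⟩ := exists_isProfile hv hper μ hd
  obtain ⟨w, hw⟩ : ∃ w, IsCellSolution v μ d H w := ⟨_, hu.isCellSolution hd hv⟩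
  refine ⟨(H, w), hw, ?_⟩
  rintro ⟨H', w'⟩ hw'
  replace hw' : IsCellSolution v μ d H' w' := hw'
  obtain ⟨hH, hslope⟩ := (hw'.isProfile hd).unique hd hv hper (hw.isProfile hd)
  have hderiv : ∀ x, deriv w' x = deriv w x := fun x => add_left_cancel (congrFun hslope x)
  refine Prod.ext hH (eq_of_fderiv_eq (𝕜 := ℝ) (hw'.contDiff.differentiable two_ne_zero)
    (hw.contDiff.differentiable two_ne_zero) (fun x => ?_) 0
    (hw'.normalized.trans hw.normalized.symm))
  ext
  simpa using hderiv x

section slope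

variable {v : ℝ → ℝ}

lemma slope_nonneg (x : ℝ) : 0 ≤ slope v x := Real.sqrt_nonneg _

lemma slope_sq (hv : ∀ x, v x ≤ 0) (x : ℝ) : slope v x ^ 2 = (1 - v x) ^ 2 - 1 :=
  Real.sq_sqrt (by nlinarith [hv x])

lemma continuous_slope (hv : Continuous v) : Continuous (slope v) := by
  unfold slope
  fun_prop

lemma periodic_slope {c : ℝ} (hper : Function.Periodic v c) : Function.Periodic (slope v) c :=
  fun x => by simp only [slope, hper x]

lemma slope_eq_zero_iff (hv : ∀ x, v x ≤ 0) {x : ℝ} : slope v x = 0 ↔ v x = 0 := by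
  rw [← sq_eq_zero_iff, slope_sq hv]
  exact ⟨fun h => by nlinarith [hv x], fun h => by simp [h]⟩

lemma sqrt_one_add_sq_le_iff_abs_le_slope (hv : ∀ x, v x ≤ 0) {a x : ℝ} :
    √(1 + a ^ 2) ≤ 1 - v x ↔ |a| ≤ slope v x := by
  rw [Real.sqrt_le_left (by linarith [hv x]), ← abs_of_nonneg (slope_nonneg (v := v) x),
    ← sq_le_sq, slope_sq hv, le_sub_iff_add_le']

lemma le_sqrt_one_add_sq_iff_slope_le_abs (hv : ∀ x, v x ≤ 0) {a x : ℝ} :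
    1 - v x ≤ √(1 + a ^ 2) ↔ slope v x ≤ |a| := by
  rw [Real.le_sqrt' (by linarith [hv x]), ← abs_of_nonneg (slope_nonneg (v := v) x),
    ← sq_le_sq, slope_sq hv, sub_le_iff_le_add']

lemma le_add_pow_four_div {t η : ℝ} (ht : 0 ≤ t) (hη : 0 < η) : t ≤ η + t ^ 4 / η ^ 3 := by
  rcases le_total t η with h | h
  · exact h.trans (le_add_of_nonneg_right (by positivity))
  · refine le_add_of_nonneg_of_le hη.le ((le_div_iff₀ (by positivity)).2 ?_)
    calc t * η ^ 3 ≤ t * t ^ 3 := by gcongr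
      _ = t ^ 4 := by ring

lemma abs_abs_sub_slope_le (hv : ∀ x, v x ≤ 0) {a x C η : ℝ} (hη : 0 < η)
    (hC : √(1 + a ^ 2) + 1 - v x ≤ C) :
    |(|a| - slope v x)| ≤ η + C ^ 2 / η ^ 3 * (√(1 + a ^ 2) + v x - 1) ^ 2 := by
  set s := slope v x
  have hs : 0 ≤ s := slope_nonneg x
  have hsum : 0 ≤ √(1 + a ^ 2) + 1 - v x := by linarith [one_le_sqrt_one_add_sq a, hv x]
  have hdiff : |a| ^ 2 - s ^ 2 = (√(1 + a ^ 2) + v x - 1) * (√(1 + a ^ 2) + 1 - v x) := by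
    rw [slope_sq hv, sq_abs]
    linear_combination -Real.sq_sqrt (by positivity : 0 ≤ 1 + a ^ 2)
  have hpow : (|(|a| - s)|) ^ 4 ≤ C ^ 2 * (√(1 + a ^ 2) + v x - 1) ^ 2 := by
    have hle : (|a| - s) ^ 2 ≤ (|a| + s) ^ 2 := by nlinarith [abs_nonneg a]
    calc (|(|a| - s)|) ^ 4 = (|a| - s) ^ 2 * (|a| - s) ^ 2 := by
          rw [(by decide : Even 4).pow_abs]; ring
      _ ≤ (|a| - s) ^ 2 * (|a| + s) ^ 2 := by gcongr
      _ = (√(1 + a ^ 2) + 1 - v x) ^ 2 * (√(1 + a ^ 2) + v x - 1) ^ 2 := by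
          rw [← mul_pow, ← mul_pow, mul_comm (√(1 + a ^ 2) + 1 - v x), ← hdiff]; ring
      _ ≤ C ^ 2 * (√(1 + a ^ 2) + v x - 1) ^ 2 := by gcongr
  calc |(|a| - s)| ≤ η + (|(|a| - s)|) ^ 4 / η ^ 3 := le_add_pow_four_div (abs_nonneg _) hη
    _ ≤ η + C ^ 2 * (√(1 + a ^ 2) + v x - 1) ^ 2 / η ^ 3 := by gcongr
    _ = η + C ^ 2 / η ^ 3 * (√(1 + a ^ 2) + v x - 1) ^ 2 := by ring

lemma slope_sub_abs_le (hv : ∀ x, v x ≤ 0) {a x C H η : ℝ} (hη : 0 < η) (hH : 1 ≤ H)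
    (hC : √(1 + a ^ 2) + 1 - v x ≤ C) :
    slope v x - |a| ≤ η + C ^ 2 / η ^ 3 * (√(1 + a ^ 2) + v x - H) ^ 2 := by
  rcases le_total (slope v x) |a| with h | h
  · exact (sub_nonpos.2 h).trans (by positivity)
  · have hlevel := (sqrt_one_add_sq_le_iff_abs_le_slope hv).2 h
    calc slope v x - |a| ≤ |(|a| - slope v x)| := by
          rw [abs_sub_comm]; exact le_abs_self _
      _ ≤ η + C ^ 2 / η ^ 3 * (√(1 + a ^ 2) + v x - 1) ^ 2 := abs_abs_sub_slope_le hv hη hC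
      _ ≤ η + C ^ 2 / η ^ 3 * (√(1 + a ^ 2) + v x - H) ^ 2 := by
          have hsq : (√(1 + a ^ 2) + v x - 1) ^ 2 ≤ (√(1 + a ^ 2) + v x - H) ^ 2 := by nlinarith
          gcongr

end slope

lemma eventually_mul_lt (E : ℝ) {ε : ℝ} (hε : 0 < ε) : ∀ᶠ d in 𝓝[>] (0 : ℝ), d * E < ε :=
  ((continuous_mul_const E).tendsto' 0 0 (zero_mul E)).mono_left nhdsWithin_le_nhds
    |>.eventually_lt_const hε

lemma integral_abs_of_ne_zero {f : ℝ → ℝ} (hf : Continuous f) (hne : ∀ x, f x ≠ 0) {a b : ℝ}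
    (hab : a ≤ b) : ∫ x in a..b, |f x| = |∫ x in a..b, f x| := by
  by_cases hpos : ∀ x, 0 < f x
  · simp only [fun x => abs_of_pos (hpos x)]
    exact (abs_of_nonneg (intervalIntegral.integral_nonneg hab fun x _ => (hpos x).le)).symm
  · obtain ⟨y, hy⟩ := not_forall.1 hpos
    have hneg : ∀ x, f x < 0 := fun x => by
      by_contra! hx
      obtain ⟨z, hz⟩ := mem_range_of_exists_le_of_exists_ge hf ⟨y, not_lt.1 hy⟩ ⟨x, hx⟩
      exact hne z hz
    simp only [fun x => abs_of_neg (hneg x), intervalIntegral.integral_neg]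
    refine (abs_of_nonpos (neg_nonneg.1 ?_)).symm
    rw [← intervalIntegral.integral_neg]
    exact intervalIntegral.integral_nonneg hab fun x _ => (neg_pos.2 (hneg x)).le

section convergence

variable {v : ℝ → ℝ} {μ : ℝ}

lemma exists_uniform_bounds (hv : ContDiff ℝ 1 v) (hper : Function.Periodic v 1)
    (hv0 : ∀ x, v x ≤ 0) (μ : ℝ) : ∃ C E : ℝ, ∀ d, 0 < d → ∀ H u, IsProfile v μ d H u →
      (∀ x, √(1 + u x ^ 2) + 1 - v x ≤ C) ∧
        ∫ x in (0 : ℝ)..1, (√(1 + u x ^ 2) + v x - H) ^ 2 ≤ d * E := by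
  obtain ⟨V, hV⟩ := exists_forall_abs_le_of_periodic one_ne_zero hv.continuous hper
  obtain ⟨D, hD⟩ := exists_forall_abs_le_of_periodic one_ne_zero (hv.continuous_deriv le_rfl)
    (periodic_deriv hper)
  have hV' : ∀ x, -V ≤ v x := fun x => neg_le_of_abs_le (hV x)
  refine ⟨√(1 + μ ^ 2) + V + 1 + V, (√(1 + μ ^ 2) + V) * D, fun d hd H u hu => ?_⟩
  have hu_le : ∀ x, √(1 + u x ^ 2) ≤ √(1 + μ ^ 2) + V := fun x => by
    linarith [hu.sqrt_one_add_sq_le hd hV' x, hu.level_le_sqrt hd hv0]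
  refine ⟨fun x => by linarith [hu_le x, hV' x],
    hu.integral_residual_sq_le hd hv hper fun x => ?_⟩
  rw [abs_mul]
  exact mul_le_mul ((abs_le_sqrt_one_add_sq _).trans (hu_le x)) (hD x) (abs_nonneg _)
    ((abs_nonneg _).trans ((abs_le_sqrt_one_add_sq _).trans (hu_le x)))

lemma eventually_level_le_one (hv : ContDiff ℝ 1 v) (hper : Function.Periodic v 1)
    (hv0 : ∀ x, v x ≤ 0) (hμ : |μ| < ∫ y in (0 : ℝ)..1, slope v y) :
    ∀ᶠ d in 𝓝[>] (0 : ℝ), ∀ H u, IsProfile v μ d H u → H ≤ 1 := by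
  obtain ⟨C, E, hbound⟩ := exists_uniform_bounds hv hper hv0 μ
  obtain ⟨η, hη, hgap⟩ : ∃ η > 0, |μ| + η + η < ∫ y in (0 : ℝ)..1, slope v y :=
    ⟨((∫ y in (0 : ℝ)..1, slope v y) - |μ|) / 3, by linarith, by linarith⟩
  filter_upwards [self_mem_nhdsWithin, eventually_mul_lt (C ^ 2 / η ^ 3 * E) hη]
    with d hd hsmall H u hu
  by_contra! hH
  obtain ⟨hC, hE⟩ := hbound d hd H u hu
  have huc := hu.continuous
  have hvc := hv.continuous
  have hsc := continuous_slope hvc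
  have habs : ∫ x in (0 : ℝ)..1, |u x| = |μ| := by
    rw [integral_abs_of_ne_zero huc (hu.ne_zero hd hv0 hH) zero_le_one, hu.mean]
  have hint := intervalIntegral.integral_mono (μ := MeasureTheory.volume) (zero_le_one' ℝ)
    (Continuous.intervalIntegrable (by fun_prop) _ _)
    (Continuous.intervalIntegrable (by fun_prop) _ _)
    fun x => slope_sub_abs_le hv0 hη hH.le (hC x)
  rw [intervalIntegral.integral_sub (hsc.intervalIntegrable _ _) (huc.abs.intervalIntegrable _ _),
    habs, intervalIntegral.integral_add (by simp)
      (Continuous.intervalIntegrable (by fun_prop) _ _),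
    intervalIntegral.integral_const_mul, intervalIntegral.integral_const, sub_zero,
    one_smul] at hint
  have hE' := mul_le_mul_of_nonneg_left hE (by positivity : 0 ≤ C ^ 2 / η ^ 3)
  linarith

lemma eventually_le_level (hv : ContDiff ℝ 1 v) (hper : Function.Periodic v 1)
    (hv0 : ∀ x, v x ≤ 0) (μ : ℝ) {a : ℝ} (ha : v a = 0) {τ : ℝ} (hτ : 0 < τ) :
    ∀ᶠ d in 𝓝[>] (0 : ℝ), ∀ H u, IsProfile v μ d H u → 1 - τ ≤ H := by
  obtain ⟨C, E, hbound⟩ := exists_uniform_bounds hv hper hv0 μ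
  have hvc := hv.continuous
  have hmass : 0 < ∫ x in (0 : ℝ)..1, (max 0 (τ + v x)) ^ 2 := by
    have hshift := (hper.comp fun t => (max 0 (τ + t)) ^ 2).intervalIntegral_add_eq a 0
    rw [zero_add] at hshift
    refine (intervalIntegral.integral_pos (lt_add_one a) (by fun_prop) (fun x _ => sq_nonneg _)
      ⟨a, left_mem_Icc.2 (lt_add_one a).le, ?_⟩).trans_eq hshift
    rw [ha, add_zero, max_eq_right hτ.le]
    positivity
  filter_upwards [self_mem_nhdsWithin, eventually_mul_lt E hmass] with d hd hsmall H u hu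
  by_contra! hH
  have huc := hu.continuous
  refine hsmall.not_ge (le_trans ?_ (hbound d hd H u hu).2)
  refine intervalIntegral.integral_mono zero_le_one
    (Continuous.intervalIntegrable (by fun_prop) _ _)
    (Continuous.intervalIntegrable (by fun_prop) _ _) fun x => sq_le_sq.2 ?_
  rw [abs_of_nonneg (le_max_left _ _)]
  exact max_le (abs_nonneg _)
    (le_trans (by linarith [one_le_sqrt_one_add_sq (u x)]) (le_abs_self _))

theorem eventually_integral_abs_abs_sub_slope_le (hv : ContDiff ℝ 1 v)
    (hper : Function.Periodic v 1) (hv0 : ∀ x, v x ≤ 0) {a : ℝ} (ha : v a = 0)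
    (hμ : |μ| < ∫ y in (0 : ℝ)..1, slope v y) (b : ℝ) {ε : ℝ} (hε : 0 < ε) :
    ∀ᶠ d in 𝓝[>] (0 : ℝ), ∀ H u, IsProfile v μ d H u →
      ∫ x in b..(b + 1), |(|u x| - slope v x)| ≤ ε := by
  obtain ⟨C, E, hbound⟩ := exists_uniform_bounds hv hper hv0 μ
  have hvc := hv.continuous
  have hsc := continuous_slope hvc
  obtain ⟨η, hη, hηε⟩ : ∃ η > 0, η + (η + η) = ε := ⟨ε / 3, by positivity, by ring⟩
  set M := C ^ 2 / η ^ 3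
  have hM : 0 ≤ M := by positivity
  obtain ⟨τ, hτ, hMτ⟩ : ∃ τ > 0, M * (2 * τ ^ 2) ≤ η := by
    have hlim : Tendsto (fun τ : ℝ => M * (2 * τ ^ 2)) (𝓝[>] 0) (𝓝 0) :=
      (Continuous.tendsto' (by fun_prop) _ _ (by simp)).mono_left nhdsWithin_le_nhds
    exact ((hlim.eventually_le_const hη).and self_mem_nhdsWithin).exists.imp fun _ => And.symm
  filter_upwards [self_mem_nhdsWithin, eventually_level_le_one hv hper hv0 hμ,
    eventually_le_level hv hper hv0 μ ha hτ, eventually_mul_lt (M * 2 * E) hη]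
    with d hd hle hge hsmall H u hu
  obtain ⟨hC, hE⟩ := hbound d hd H u hu
  have huc := hu.continuous
  have hpointwise : ∀ x, |(|u x| - slope v x)| ≤
      η + (M * 2 * (√(1 + u x ^ 2) + v x - H) ^ 2 + M * (2 * τ ^ 2)) := fun x => by
    have hlevel : (√(1 + u x ^ 2) + v x - 1) ^ 2 ≤
        2 * (√(1 + u x ^ 2) + v x - H) ^ 2 + 2 * τ ^ 2 := by
      nlinarith [sq_nonneg ((√(1 + u x ^ 2) + v x - H) - (H - 1)), hle H u hu, hge H u hu]
    linarith [abs_abs_sub_slope_le hv0 hη (hC x), mul_le_mul_of_nonneg_left hlevel hM]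
  have hperiodic : Function.Periodic (fun x => |(|u x| - slope v x)|) 1 := fun x => by
    simp only [hu.periodic x, periodic_slope hper x]
  have hint := intervalIntegral.integral_mono (μ := MeasureTheory.volume) (zero_le_one' ℝ)
    (Continuous.intervalIntegrable (by fun_prop) _ _)
    (Continuous.intervalIntegrable (by fun_prop) _ _) hpointwise
  rw [intervalIntegral.integral_add (by simp) (Continuous.intervalIntegrable (by fun_prop) _ _),
    intervalIntegral.integral_add (Continuous.intervalIntegrable (by fun_prop) _ _) (by simp),
    intervalIntegral.integral_const_mul, intervalIntegral.integral_const,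
    intervalIntegral.integral_const, sub_zero, one_smul, one_smul] at hint
  rw [hperiodic.intervalIntegral_add_eq b 0, zero_add]
  linarith [mul_le_mul_of_nonneg_left hE (by positivity : 0 ≤ M * 2)]

end convergence

section maxima

variable {v : ℝ → ℝ}

lemma isLittleO_of_contDiff_two {f : ℝ → ℝ} (hf : ContDiff ℝ 2 f) (a : ℝ) :
    (fun x => f x - (f a + deriv f a * (x - a) + deriv (deriv f) a / 2 * (x - a) ^ 2))
      =o[𝓝 a] fun x => (x - a) ^ 2 := by
  refine (taylor_isLittleO_univ (n := 2) (x₀ := a) hf).congr_left fun x => ?_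
  simp [taylorWithinEval_succ, iteratedDerivWithin_univ, iteratedDeriv_succ]
  ring

lemma deriv_deriv_nonpos_of_isLocalMax {f : ℝ → ℝ} {a : ℝ} (hf : ContinuousAt f a)
    (hmax : IsLocalMax f a) : deriv (deriv f) a ≤ 0 := by
  by_contra! hpos
  have hmin : IsLocalMin f a := isLocalMin_of_deriv_deriv_pos hpos hmax.deriv_eq_zero hf
  have hconst : f =ᶠ[𝓝 a] fun _ => f a := by
    filter_upwards [hmax, hmin] with x hle hge using le_antisymm hle hge
  have hzero := hconst.deriv.deriv_eq
  simp only [deriv_const'] at hzero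
  exact hpos.ne' hzero

lemma slope_sq_isLittleO (hv : ContDiff ℝ 2 v) (hv0 : ∀ x, v x ≤ 0) {a : ℝ} (ha : v a = 0) :
    (fun x => slope v x ^ 2 - |deriv (deriv v) a| * (x - a) ^ 2) =o[𝓝 a] fun x => (x - a) ^ 2 := by
  have hmax : IsLocalMax v a := Eventually.of_forall fun x => ha ▸ hv0 x
  have hvo := isLittleO_of_contDiff_two hv a
  simp only [ha, hmax.deriv_eq_zero, zero_mul, zero_add] at hvo
  have hvO : v =O[𝓝 a] fun x => (x - a) ^ 2 := by
    simpa using hvo.isBigO.add (Asymptotics.isBigO_const_mul_self (deriv (deriv v) a / 2) _ _)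
  have hv1 : v =o[𝓝 a] fun _ => (1 : ℝ) :=
    (Asymptotics.isLittleO_one_iff ℝ).2 (ha ▸ hv.continuous.continuousAt.tendsto)
  refine ((hvO.mul_isLittleO hv1).congr_right fun x => mul_one _).sub (hvo.const_mul_left 2)
    |>.congr_left fun x => ?_
  rw [slope_sq hv0,
    abs_of_nonpos (deriv_deriv_nonpos_of_isLocalMax hv.continuous.continuousAt hmax)]
  ring

lemma eventually_slope_le (hv : ContDiff ℝ 2 v) (hv0 : ∀ x, v x ≤ 0) {a κ : ℝ} (ha : v a = 0)
    (hκ0 : 0 ≤ κ) (hκ : |deriv (deriv v) a| < κ ^ 2) :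
    ∀ᶠ x in 𝓝 a, slope v x ≤ κ * |x - a| := by
  filter_upwards [(slope_sq_isLittleO hv hv0 ha).def (sub_pos.2 hκ)] with x hx
  rw [Real.norm_eq_abs, Real.norm_eq_abs, abs_of_nonneg (sq_nonneg (x - a))] at hx
  refine (sq_le_sq₀ (slope_nonneg x) (by positivity)).1 ?_
  rw [mul_pow, sq_abs]
  linarith [le_abs_self (slope v x ^ 2 - |deriv (deriv v) a| * (x - a) ^ 2)]

lemma eventually_le_slope (hv : ContDiff ℝ 2 v) (hv0 : ∀ x, v x ≤ 0) {a κ : ℝ} (ha : v a = 0)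
    (hκ : κ ^ 2 < |deriv (deriv v) a|) : ∀ᶠ x in 𝓝 a, κ * |x - a| ≤ slope v x := by
  filter_upwards [(slope_sq_isLittleO hv hv0 ha).def (sub_pos.2 hκ)] with x hx
  rw [Real.norm_eq_abs, Real.norm_eq_abs, abs_of_nonneg (sq_nonneg (x - a))] at hx
  refine le_of_sq_le_sq ?_ (slope_nonneg x)
  rw [mul_pow, sq_abs]
  linarith [neg_abs_le (slope v x ^ 2 - |deriv (deriv v) a| * (x - a) ^ 2)]
end maxima

lemma mul_sub_le_integral_of_le {f : ℝ → ℝ} (hf : Continuous f) (hf0 : ∀ x, 0 ≤ f x)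
    {a b p q m : ℝ} (hap : a ≤ p) (hpq : p ≤ q) (hqb : q ≤ b) (hm : ∀ x ∈ Icc p q, m ≤ f x) :
    m * (q - p) ≤ ∫ x in a..b, f x :=
  calc m * (q - p) = ∫ _ in p..q, m := by
        rw [intervalIntegral.integral_const, smul_eq_mul, mul_comm]
    _ ≤ ∫ x in p..q, f x :=
        intervalIntegral.integral_mono_on hpq (by simp) (hf.intervalIntegrable _ _) hm
    _ ≤ ∫ x in a..b, f x :=
        intervalIntegral.integral_mono_interval hap hpq hqb (Eventually.of_forall hf0)
          (hf.intervalIntegrable _ _)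

lemma exists_forall_mem_Icc_of_eventually {P : ℝ → Prop} {a R : ℝ} (h : ∀ᶠ x in 𝓝 a, P x)
    (hR : 0 < R) : ∃ r, 0 < r ∧ r < R ∧ ∀ x ∈ Icc (a - r) (a + r), P x := by
  obtain ⟨ρ, hρ, hball⟩ := Metric.nhds_basis_closedBall.eventually_iff.1 h
  refine ⟨min ρ (R / 2), by positivity, (min_le_right _ _).trans_lt (half_lt_self hR),
    fun x hx => hball (Metric.closedBall_subset_closedBall (min_le_left _ (R / 2)) ?_)⟩
  rwa [Real.closedBall_eq_Icc]

lemma exists_lt_sq_lt {A B : ℝ} (hB : 0 < B) (hAB : A < B) : ∃ κ > 0, A < κ ^ 2 ∧ κ ^ 2 < B := by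
  obtain ⟨t, hlow, hhigh⟩ := exists_between (max_lt hB hAB)
  obtain ⟨h0t, hAt⟩ := max_lt_iff.1 hlow
  exact ⟨√t, Real.sqrt_pos.2 h0t, by rwa [Real.sq_sqrt h0t.le], by rwa [Real.sq_sqrt h0t.le]⟩

section level

variable {v u : ℝ → ℝ} {μ d H a κ r : ℝ}

lemma IsProfile.mul_sub_lt_of_mul_sub_le (hd : 0 < d) (hv : ∀ x, v x ≤ 0)
    (hu : IsProfile v μ d H u) (hκ : 0 < κ)
    (hs : ∀ x ∈ Icc (a - r) (a + r), slope v x ≤ κ * |x - a|) (hH : d * κ < 1 - H) {x y : ℝ}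
    (hx : a - r ≤ x) (hxy : x < y) (hy : y ≤ a + r) (hux : κ * (x - a) ≤ u x) :
    κ * (y - a) < u y := by
  have hdiff : ∀ t, HasDerivAt (fun t => u t - κ * (t - a)) (profileField d H (v t) (u t) - κ) t :=
    fun t => ((hu.hasDerivAt t).sub (((hasDerivAt_id t).sub_const a).const_mul κ)).congr_deriv
      (by rw [mul_one])
  refine sub_pos.1 (pos_of_deriv_pos_of_eq_zero (f := fun t => u t - κ * (t - a)) hxy
    (fun t _ => (hdiff t).hasDerivWithinAt) (fun t ht htline => sub_pos.2 ?_) (sub_nonneg.2 hux))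
  have hslope : slope v t ≤ |u t| := by
    rw [sub_eq_zero.1 htline, abs_mul, abs_of_pos hκ]
    exact hs t ⟨hx.trans ht.1, ht.2.trans hy⟩
  have hresidual : d * κ < √(1 + u t ^ 2) + v t - H := by
    linarith [(le_sqrt_one_add_sq_iff_slope_le_abs hv).2 hslope]
  rw [profileField, lt_div_iff₀ hd, mul_comm κ]
  nlinarith [mul_pos hd hκ, sq_nonneg (u t)]

lemma IsProfile.mul_abs_sub_le_abs_right_or_left (hd : 0 < d) (hv : ∀ x, v x ≤ 0)
    (hu : IsProfile v μ d H u) (hκ : 0 < κ) (hr : 0 ≤ r)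
    (hs : ∀ x ∈ Icc (a - r) (a + r), slope v x ≤ κ * |x - a|) (hH : d * κ < 1 - H) :
    (∀ x ∈ Ioc a (a + r), κ * |x - a| ≤ |u x|) ∨ ∀ x ∈ Ico (a - r) a, κ * |x - a| ≤ |u x| := by
  have hline := fun x y => hu.mul_sub_lt_of_mul_sub_le hd hv hκ hs hH (x := x) (y := y)
  rcases le_total 0 (u a) with hua | hua
  · refine Or.inl fun x hx => ?_
    rw [abs_of_pos (sub_pos.2 hx.1)]
    exact (hline a x (by linarith) hx.1 hx.2 (by simpa using hua)).le.trans (le_abs_self _)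
  · refine Or.inr fun x hx => ?_
    have hbelow : u x < κ * (x - a) := by
      by_contra! habove
      have hpos := hline x a hx.1 hx.2 (by linarith) habove
      rw [sub_self, mul_zero] at hpos
      exact hpos.not_ge hua
    rw [abs_of_neg (sub_neg.2 hx.2)]
    linarith [neg_le_abs (u x)]

theorem eventually_one_sub_level_le (hv : ContDiff ℝ 2 v) (hper : Function.Periodic v 1)
    (hv0 : ∀ x, v x ≤ 0) (hμ : |μ| < ∫ y in (0 : ℝ)..1, slope v y) (ha : v a = 0)
    (hκ0 : 0 < κ) (hκ : |deriv (deriv v) a| < κ ^ 2) :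
    ∀ᶠ d in 𝓝[>] (0 : ℝ), ∀ H u, IsProfile v μ d H u → 1 - H ≤ d * κ := by
  obtain ⟨κ₁, hκ₁0, hκ₁, hκ₁κ⟩ := exists_lt_sq_lt (by positivity) hκ
  replace hκ₁κ : κ₁ < κ := lt_of_pow_lt_pow_left₀ 2 hκ0.le hκ₁κ
  obtain ⟨r, hr, hr1, hs⟩ := exists_forall_mem_Icc_of_eventually
    (eventually_slope_le hv hv0 ha hκ₁0.le hκ₁) (R := 1 / 2) (by norm_num)
  set m := (κ - κ₁) * (r / 2)
  have : 0 < m := mul_pos (by linarith) (by linarith)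
  filter_upwards [self_mem_nhdsWithin, eventually_integral_abs_abs_sub_slope_le
    (hv.of_le one_le_two) hper hv0 ha hμ (a - 1 / 2) (by positivity : 0 < m * (r / 2) / 2)]
    with d hd hclose H u hu
  by_contra! hH
  obtain ⟨p, hpl, hpr, hgap⟩ : ∃ p, a - 1 / 2 ≤ p ∧ p + r / 2 ≤ a + 1 / 2 ∧
      ∀ x ∈ Icc p (p + r / 2), x ∈ Icc (a - r) (a + r) ∧ r / 2 ≤ |x - a| ∧
        κ * |x - a| ≤ |u x| := by
    rcases hu.mul_abs_sub_le_abs_right_or_left hd hv0 hκ0 hr.le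
      (fun x hx => (hs x hx).trans (by gcongr)) hH with hright | hleft
    · refine ⟨a + r / 2, by linarith, by linarith, fun x ⟨hx1, hx2⟩ =>
        ⟨⟨by linarith, by linarith⟩, ?_, hright x ⟨by linarith, by linarith⟩⟩⟩
      exact le_trans (by linarith) (le_abs_self _)
    · refine ⟨a - r, by linarith, by linarith, fun x ⟨hx1, hx2⟩ =>
        ⟨⟨by linarith, by linarith⟩, ?_, hleft x ⟨by linarith, by linarith⟩⟩⟩
      exact le_trans (by linarith) (neg_le_abs _)
  have huc := hu.continuous
  have hsc := continuous_slope hv.continuous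
  have hmass := mul_sub_le_integral_of_le (f := fun x => |(|u x| - slope v x)|) (by fun_prop)
    (fun x => abs_nonneg _) hpl (by linarith) (show p + r / 2 ≤ a - 1 / 2 + 1 by linarith)
    (m := m) fun x hx => ?_
  · rw [add_sub_cancel_left] at hmass
    linarith [hclose H u hu, (by positivity : 0 < m * (r / 2))]
  · obtain ⟨hxr, hxa, hux⟩ := hgap x hx
    refine le_trans (?_ : (κ - κ₁) * (r / 2) ≤ _) (le_abs_self _)
    linarith [hs x hxr, mul_le_mul_of_nonneg_left hxa (sub_nonneg.2 hκ₁κ.le)]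

end level

lemma exists_polynomial_eval_eq_zero_derivative_eq {F : Type*} [Field F] (s : Finset F)
    (c : F → F) :
    ∃ P : Polynomial F, ∀ e ∈ s, P.eval e = 0 ∧ P.derivative.eval e = c e := by
  classical
  refine ⟨Lagrange.nodal s id *
    Lagrange.interpolate s id (fun e => Lagrange.nodalWeight s id e * c e), fun e he => ?_⟩
  have hnode : (Lagrange.nodal s id).eval e = 0 := Lagrange.eval_nodal_at_node (v := id) he
  have hweight := Lagrange.nodalWeight_ne_zero (injOn_id _) he
  have hderiv : (Lagrange.nodal s id).derivative.eval e = (Lagrange.nodalWeight s id e)⁻¹ := by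
    rw [Lagrange.nodalWeight_eq_eval_derivative_nodal he, inv_inv, id]
  have hvalue := Lagrange.eval_interpolate_at_node
    (fun e => Lagrange.nodalWeight s id e * c e) (injOn_id (s : Set F)) he
  rw [id] at hvalue
  simp only [Polynomial.derivative_mul, Polynomial.eval_add, Polynomial.eval_mul, hnode, hderiv,
    hvalue, zero_mul, add_zero, true_and]
  exact inv_mul_cancel_left₀ hweight _

-- Away from the points where `f` is already small, dividing by `1 + (f / m)²` with `m` small
-- brings `|f|` below `m`, without changing its derivative at the zeros of `f`.
lemma exists_contDiff_abs_le_of_isCompact {f g : ℝ → ℝ} {K : Set ℝ} (hf : ContDiff ℝ 1 f)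
    (hK : IsCompact K) (hg : ContinuousOn g K)
    (h : ∀ x ∈ K, g x ≤ 0 → ∀ᶠ y in 𝓝 x, |f y| ≤ g y) :
    ∃ ψ : ℝ → ℝ, ContDiff ℝ 1 ψ ∧ (∀ x ∈ K, |ψ x| ≤ g x) ∧
      ∀ x, f x = 0 → deriv ψ x = deriv f x := by
  set O := interior {x | |f x| ≤ g x}
  obtain ⟨m, hm, hmg⟩ : ∃ m, 0 < m ∧ ∀ x ∈ K \ O, m ≤ g x :=
    (hK.diff isOpen_interior).exists_forall_le' (hg.mono sdiff_subset) fun x hx => by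
      by_contra! hgx
      exact hx.2 (mem_interior_iff_mem_nhds.2 (h x hx.1 hgx))
  have hden : ∀ x, 0 < 1 + (m⁻¹ * f x) ^ 2 := fun x => by positivity
  refine ⟨fun x => f x / (1 + (m⁻¹ * f x) ^ 2), hf.div (by fun_prop) fun x => (hden x).ne',
    fun x hx => ?_, fun x hx => ?_⟩
  · rw [abs_div, abs_of_pos (hden x), div_le_iff₀ (hden x)]
    by_cases hxO : x ∈ O
    · have hfx : |f x| ≤ g x := (interior_subset hxO : x ∈ {x | |f x| ≤ g x})
      nlinarith [sq_nonneg (m⁻¹ * f x), abs_nonneg (f x)]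
    · calc |f x| = m * (m⁻¹ * |f x|) := by field_simp
        _ ≤ m * (1 + (m⁻¹ * f x) ^ 2) := by
          gcongr
          rw [mul_pow, ← sq_abs (f x), ← mul_pow]
          nlinarith [sq_nonneg (m⁻¹ * |f x| - 1)]
        _ ≤ g x * (1 + (m⁻¹ * f x) ^ 2) := by gcongr; exact hmg x ⟨hx, hxO⟩
  · have hfx := (hf.differentiable one_ne_zero x).hasDerivAt
    refine ((hfx.div (((hfx.const_mul m⁻¹).pow 2).const_add 1) (hden x).ne').congr_deriv ?_).deriv
    simp [hx]

lemma eventually_forall_mul_lt_of_isCompact {A B : ℝ → ℝ} {K : Set ℝ} (hK : IsCompact K)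
    (hA : ContinuousOn A K) (hB : ContinuousOn B K) (hA0 : ∀ x ∈ K, 0 ≤ A x)
    (hAB : ∀ x ∈ K, A x = 0 → B x < 0) : ∀ᶠ d in 𝓝[>] (0 : ℝ), ∀ x ∈ K, d * B x < A x := by
  have hK' : IsCompact (K ∩ B ⁻¹' Ici 0) :=
    hK.of_isClosed_subset (hB.preimage_isClosed_of_isClosed hK.isClosed isClosed_Ici)
      inter_subset_left
  obtain ⟨c, hc, hcA⟩ := hK'.exists_forall_le' (a := 0) (hA.mono inter_subset_left)
    fun x hx => (hA0 x hx.1).lt_of_ne fun hAx => (hAB x hx.1 hAx.symm).not_ge hx.2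
  obtain ⟨C, hC⟩ := hK.exists_bound_of_continuousOn hB
  filter_upwards [self_mem_nhdsWithin, eventually_mul_lt C hc] with d (hd : 0 < d) hdC x hx
  rcases lt_or_ge (B x) 0 with hBx | hBx
  · exact (mul_neg_of_pos_of_neg hd hBx).trans_le (hA0 x hx)
  · calc d * B x ≤ d * C := by gcongr; exact (le_abs_self _).trans (hC x hx)
      _ < c := hdC
      _ ≤ A x := hcA x ⟨hx, hBx⟩

section barrier

variable {v ψ : ℝ → ℝ} {κ θ p q : ℝ}

/-- A barrier on `[p, q]`: a `C¹` function in the band `|y| ≤ θ slope v`, with derivative `κ` at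
the zeros of `v`. For `θ < 1`, `κ' < κ` and small `d`, a profile with `1 - H ≤ d κ'` can cross it
only downwards. -/
structure IsBarrier (v : ℝ → ℝ) (p q κ θ : ℝ) (ψ : ℝ → ℝ) : Prop where
  contDiff : ContDiff ℝ 1 ψ
  abs_le : ∀ x ∈ Icc p q, |ψ x| ≤ θ * slope v x
  deriv_eq : ∀ e ∈ Icc p q, v e = 0 → deriv ψ e = κ

lemma eventually_abs_le_mul_slope (hv : ContDiff ℝ 2 v) (hv0 : ∀ x, v x ≤ 0) {φ : ℝ → ℝ} {e : ℝ}
    (hφ : HasDerivAt φ κ e) (hφe : φ e = 0) (he : v e = 0) (hθ : 0 < θ)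
    (hκ : κ ^ 2 < θ ^ 2 * |deriv (deriv v) e|) : ∀ᶠ x in 𝓝 e, |φ x| ≤ θ * slope v x := by
  obtain ⟨κ', hκ'0, hκκ', hκ'⟩ := exists_lt_sq_lt ((sq_nonneg κ).trans_lt hκ) hκ
  have hκlt : 0 < κ' - |κ| := sub_pos.2 (abs_lt_of_sq_lt_sq hκκ' hκ'0.le)
  have hκ'θ : (κ' / θ) ^ 2 < |deriv (deriv v) e| := by
    rwa [div_pow, div_lt_iff₀' (by positivity)]
  filter_upwards [(hasDerivAt_iff_isLittleO.1 hφ).def hκlt, eventually_le_slope hv hv0 he hκ'θ]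
    with x hlin hslope
  rw [hφe, sub_zero, smul_eq_mul, Real.norm_eq_abs, Real.norm_eq_abs] at hlin
  calc |φ x| ≤ |φ x - (x - e) * κ| + |(x - e) * κ| := by
        simpa using abs_add_le (φ x - (x - e) * κ) ((x - e) * κ)
    _ ≤ κ' * |x - e| := by rw [abs_mul]; linarith
    _ = θ * (κ' / θ * |x - e|) := by field_simp
    _ ≤ θ * slope v x := by gcongr

lemma finite_setOf_eq_zero_of_deriv_deriv_ne_zero (hv : ContDiff ℝ 2 v) (hv0 : ∀ x, v x ≤ 0)
    {K : Set ℝ} (hK : IsCompact K) (h : ∀ e ∈ K, v e = 0 → deriv (deriv v) e ≠ 0) :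
    {x ∈ K | v x = 0}.Finite := by
  by_contra hinf
  obtain ⟨e, heK, he⟩ := Set.Infinite.exists_accPt_of_subset_isCompact hinf hK (sep_subset K _)
  have hve : v e = 0 := (isClosed_singleton.preimage hv.continuous).closure_subset_iff.2
    (fun x hx => hx.2) (mem_closure_iff_clusterPt.2 he.clusterPt)
  obtain ⟨κ, hκ0, -, hκ⟩ := exists_lt_sq_lt (abs_pos.2 (h e heK hve)) (abs_pos.2 (h e heK hve))
  obtain ⟨x, ⟨hxe, -, hvx⟩, hslope⟩ :=
    ((accPt_iff_frequently.1 he).and_eventually (eventually_le_slope hv hv0 hve hκ)).exists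
  rw [(slope_eq_zero_iff hv0).2 hvx] at hslope
  exact (mul_pos hκ0 (abs_pos.2 (sub_ne_zero.2 hxe))).not_ge hslope

lemma exists_isBarrier (hv : ContDiff ℝ 2 v) (hv0 : ∀ x, v x ≤ 0)
    (hκ : ∀ e ∈ Icc p q, v e = 0 → κ ^ 2 < |deriv (deriv v) e|) :
    ∃ θ ∈ Ioo (0 : ℝ) 1, ∃ ψ, IsBarrier v p q κ θ ψ := by
  have hfin := finite_setOf_eq_zero_of_deriv_deriv_ne_zero hv hv0 isCompact_Icc
    fun e he hve => abs_pos.1 ((sq_nonneg κ).trans_lt (hκ e he hve))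
  obtain ⟨P, hP⟩ := exists_polynomial_eval_eq_zero_derivative_eq hfin.toFinset fun _ => κ
  replace hP : ∀ e ∈ Icc p q, v e = 0 → P.eval e = 0 ∧ P.derivative.eval e = κ :=
    fun e he hve => hP e (hfin.mem_toFinset.2 ⟨he, hve⟩)
  obtain ⟨θ, hθκ, hθ⟩ : ∃ θ : ℝ, (∀ e ∈ {x ∈ Icc p q | v x = 0},
      κ ^ 2 < θ ^ 2 * |deriv (deriv v) e|) ∧ θ ∈ Ioo (0 : ℝ) 1 := by
    refine (((eventually_all_finite hfin).2 fun e he => ?_).and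
      (Ioo_mem_nhdsLT zero_lt_one)).exists
    refine Tendsto.eventually_const_lt (hκ e he.1 he.2) (Tendsto.mono_left ?_ nhdsWithin_le_nhds)
    exact Continuous.tendsto' (by fun_prop) _ _ (by simp)
  have hsc := continuous_slope hv.continuous
  obtain ⟨ψ, hψ, hψle, hψ'⟩ := exists_contDiff_abs_le_of_isCompact (f := fun x => P.eval x)
    (g := fun x => θ * slope v x) (by simpa using P.contDiff_aeval (𝕜 := ℝ) 1)
    (isCompact_Icc (a := p) (b := q)) (by fun_prop) fun x hx hslope => by
      have hvx : v x = 0 := (slope_eq_zero_iff hv0).1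
        ((nonpos_of_mul_nonpos_right hslope hθ.1).antisymm (slope_nonneg x))
      obtain ⟨hPx, hP'x⟩ := hP x hx hvx
      exact eventually_abs_le_mul_slope hv hv0 (hP'x ▸ P.hasDerivAt x) hPx hvx hθ.1
        (hθκ x ⟨hx, hvx⟩)
  refine ⟨θ, hθ, ψ, hψ, hψle, fun e he hve => ?_⟩
  obtain ⟨hPe, hP'e⟩ := hP e he hve
  rw [hψ' e hPe, Polynomial.deriv, hP'e]

lemma IsBarrier.eventually_profileField_lt_deriv (hψ : IsBarrier v p q κ θ ψ) (hθ : θ < 1)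
    (hv : Continuous v) (hv0 : ∀ x, v x ≤ 0) {κ' : ℝ} (hκ : κ' < κ) :
    ∀ᶠ d in 𝓝[>] (0 : ℝ), ∀ H, 1 - H ≤ d * κ' →
      ∀ x ∈ Icc p q, profileField d H (v x) (ψ x) < deriv ψ x := by
  have hψc := hψ.contDiff.continuous
  have hψ'c := hψ.contDiff.continuous_deriv le_rfl
  have hψs : ∀ x ∈ Icc p q, |ψ x| ≤ slope v x := fun x hx =>
    (hψ.abs_le x hx).trans (mul_le_of_le_one_left (slope_nonneg x) hθ.le)
  have hsmall := eventually_forall_mul_lt_of_isCompact (isCompact_Icc (a := p) (b := q))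
    (A := fun x => (1 + ψ x ^ 2) * (1 - v x - √(1 + ψ x ^ 2)))
    (B := fun x => κ' * (1 + ψ x ^ 2) - deriv ψ x) (by fun_prop) (by fun_prop)
    (fun x hx => mul_nonneg (by positivity)
      (sub_nonneg.2 ((sqrt_one_add_sq_le_iff_abs_le_slope hv0).2 (hψs x hx))))
    fun x hx hA => by
      have hgap := (mul_eq_zero.1 hA).resolve_left (by positivity)
      have hslope := (le_sqrt_one_add_sq_iff_slope_le_abs hv0).1 (sub_eq_zero.1 hgap).le
      have hzero : slope v x = 0 := by
        nlinarith [hψ.abs_le x hx, slope_nonneg (v := v) x]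
      have hψx : ψ x = 0 := abs_nonpos_iff.1 (hzero ▸ hψs x hx)
      rw [hψ.deriv_eq x hx ((slope_eq_zero_iff hv0).1 hzero), hψx]
      linarith
  filter_upwards [self_mem_nhdsWithin, hsmall] with d hd hsmall H hH x hx
  rw [profileField, div_lt_iff₀ hd]
  nlinarith [hsmall x hx, sq_nonneg (ψ x)]

end barrier

lemma exists_crossing_of_deriv_neg {f f' : ℝ → ℝ} {p q : ℝ} (hpq : p ≤ q)
    (hf : ∀ x ∈ Icc p q, HasDerivAt f (f' x) x) (hneg : ∀ x ∈ Icc p q, f x = 0 → f' x < 0) :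
    ∃ z ∈ Icc p q, (∀ x ∈ Ico p z, 0 ≤ f x) ∧ ∀ x ∈ Ioc z q, f x ≤ 0 := by
  set A := insert q {x ∈ Icc p q | f x ≤ 0}
  have hqA : q ∈ A := mem_insert _ _
  have hAsub : A ⊆ Icc p q := insert_subset (right_mem_Icc.2 hpq) (sep_subset _ _)
  have hbdd : BddBelow A := ⟨p, fun x hx => (hAsub hx).1⟩
  refine ⟨sInf A, ⟨le_csInf ⟨q, hqA⟩ fun x hx => (hAsub hx).1, csInf_le hbdd hqA⟩,
    fun x hx => ?_, fun x hx => ?_⟩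
  · by_contra! hfx
    have hxq := hx.2.le.trans (csInf_le hbdd hqA)
    exact hx.2.not_ge (csInf_le hbdd (Or.inr ⟨⟨hx.1, hxq⟩, hfx.le⟩))
  · obtain ⟨y, hyA, hyx⟩ := exists_lt_of_csInf_lt ⟨q, hqA⟩ hx.1
    obtain ⟨hy, hfy⟩ := hyA.resolve_left (hyx.trans_le hx.2).ne
    have hsub : Icc y x ⊆ Icc p q := Icc_subset_Icc hy.1 hx.2
    exact neg_nonneg.1 (pos_of_deriv_pos_of_eq_zero (f := fun t => -f t) hyx
      (fun t ht => (hf t (hsub ht)).neg.hasDerivWithinAt)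
      (fun t ht hft => neg_pos.2 (hneg t (hsub ht) (neg_eq_zero.1 hft))) (neg_nonneg.2 hfy)).le

lemma abs_sub_le_of_le_of_abs_le {a b s θ : ℝ} (hs : 0 ≤ s) (hθ : θ ∈ Ioo (0 : ℝ) 1)
    (hb : |b| ≤ θ * s) (hba : b ≤ a) : |a - s| ≤ (1 + θ) / (1 - θ) * |(|a| - s)| := by
  obtain ⟨hθ0, hθ1⟩ := hθ
  rcases le_or_gt 0 a with ha | ha
  · rw [abs_of_nonneg ha]
    exact le_mul_of_one_le_left (abs_nonneg _) (by rw [one_le_div (by linarith)]; linarith)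
  · have hθs : θ * s ≤ s := mul_le_of_le_one_left hs hθ1.le
    have haθ : -a ≤ θ * s := by linarith [neg_abs_le b]
    rw [abs_of_neg ha, abs_of_nonpos (by linarith), abs_of_nonpos (by linarith),
      div_mul_eq_mul_div, le_div_iff₀ (by linarith)]
    nlinarith

lemma abs_add_le_of_le_of_abs_le {a b s θ : ℝ} (hs : 0 ≤ s) (hθ : θ ∈ Ioo (0 : ℝ) 1)
    (hb : |b| ≤ θ * s) (hab : a ≤ b) : |a + s| ≤ (1 + θ) / (1 - θ) * |(|a| - s)| := by
  have h := abs_sub_le_of_le_of_abs_le hs hθ (by rwa [abs_neg]) (neg_le_neg hab)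
  rwa [abs_neg, ← abs_neg, neg_sub, sub_neg_eq_add, add_comm] at h

lemma integral_le_add_mul_integral_add {f g : ℝ → ℝ} (hf : Continuous f) (hg : Continuous g)
    {a p q b M K : ℝ} (hap : a ≤ p) (hpq : p ≤ q) (hqb : q ≤ b) (hM : ∀ x, f x ≤ M)
    (hK : ∀ x ∈ Ioo p q, f x ≤ K * g x) :
    ∫ x in a..b, f x ≤ M * (p - a) + K * (∫ x in p..q, g x) + M * (b - q) := by
  have hfi := fun c d => hf.intervalIntegrable (μ := MeasureTheory.volume) c d
  have hend : ∀ c d, c ≤ d → ∫ x in c..d, f x ≤ M * (d - c) := fun c d hcd => by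
    simpa [mul_comm] using intervalIntegral.integral_mono hcd (hfi c d)
      (intervalIntegrable_const (c := M)) hM
  have hmid : ∫ x in p..q, f x ≤ K * ∫ x in p..q, g x := by
    rw [← intervalIntegral.integral_const_mul]
    exact intervalIntegral.integral_mono_on_of_le_Ioo hpq (hfi p q)
      ((hg.const_mul K).intervalIntegrable p q) hK
  rw [← intervalIntegral.integral_add_adjacent_intervals (hfi a q) (hfi q b),
    ← intervalIntegral.integral_add_adjacent_intervals (hfi a p) (hfi p q)]
  exact add_le_add (add_le_add (hend a p hap) hmid) (hend q b hqb)

lemma abs_integral_le_integral_abs_of_subinterval {f : ℝ → ℝ} (hf : Continuous f) {a b c d : ℝ}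
    (hca : c ≤ a) (hab : a ≤ b) (hbd : b ≤ d) : |∫ x in a..b, f x| ≤ ∫ x in c..d, |f x| :=
  (intervalIntegral.abs_integral_le_integral_abs hab).trans
    (intervalIntegral.integral_mono_interval hca hab hbd
      (Eventually.of_forall fun x => abs_nonneg (f x)) (hf.abs.intervalIntegrable c d))

lemma abs_integral_sub_min_le {u s : ℝ → ℝ} (hu : Continuous u) (hs : Continuous s)
    (hs0 : ∀ x, 0 ≤ s x) {a z b ε : ℝ} (hz : z ∈ Icc a b)
    (h : (∫ x in a..z, |u x - s x|) + ∫ x in z..b, |u x + s x| ≤ ε) {x : ℝ} (hx : x ∈ Icc a b) :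
    |(∫ y in a..x, u y) - min (∫ y in a..x, s y) ((∫ y in a..b, u y) + ∫ y in x..b, s y)|
      ≤ 2 * ε := by
  have hui := fun c d => hu.intervalIntegrable (μ := MeasureTheory.volume) c d
  have hsi := fun c d => hs.intervalIntegrable (μ := MeasureTheory.volume) c d
  have hmono : ∀ p q c d, p ≤ c → c ≤ d → d ≤ q → ∫ y in c..d, s y ≤ ∫ y in p..q, s y :=
    fun p q c d hpc hcd hdq => intervalIntegral.integral_mono_interval hpc hcd hdq
      (Eventually.of_forall hs0) (hsi p q)
  have hleft : ∀ x ∈ Icc a z, |(∫ y in a..x, u y) - ∫ y in a..x, s y|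
      ≤ ∫ y in a..z, |u y - s y| := fun x hx => by
    rw [← intervalIntegral.integral_sub (hui _ _) (hsi _ _)]
    exact abs_integral_le_integral_abs_of_subinterval (hu.sub hs) le_rfl hx.1 hx.2
  have hright : ∀ x ∈ Icc z b, |(∫ y in a..x, u y) - ((∫ y in a..b, u y) + ∫ y in x..b, s y)|
      ≤ ∫ y in z..b, |u y + s y| := fun x hx => by
    rw [← intervalIntegral.integral_add_adjacent_intervals (hui a x) (hui x b), ← abs_neg,
      show ∀ A B C : ℝ, -(A - (A + B + C)) = B + C by intros; ring,
      ← intervalIntegral.integral_add (hui _ _) (hsi _ _)]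
    exact abs_integral_le_integral_abs_of_subinterval (hu.add hs) hx.1 hx.2 le_rfl
  have hzleft := abs_le.1 (hleft z ⟨hz.1, le_rfl⟩)
  have hzright := abs_le.1 (hright z ⟨le_rfl, hz.2⟩)
  rw [abs_le]
  rcases le_total x z with hxz | hzx
  · have hux := abs_le.1 (hleft x ⟨hx.1, hxz⟩)
    have hxS := hmono a z a x le_rfl hx.1 hxz
    have hxT := hmono x b z b hxz hz.2 le_rfl
    constructor <;> cases min_cases (∫ y in a..x, s y) ((∫ y in a..b, u y) + ∫ y in x..b, s y) <;>
      linarith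
  · have hux := abs_le.1 (hright x ⟨hzx, hx.2⟩)
    have hxS := hmono a x a z le_rfl hz.1 hzx
    have hxT := hmono z b x b hzx hx.2 le_rfl
    constructor <;> cases min_cases (∫ y in a..x, s y) ((∫ y in a..b, u y) + ∫ y in x..b, s y) <;>
      linarith

section limit

variable {v ψ u : ℝ → ℝ} {μ κ θ p q a b d H M : ℝ}

/-- The limit of the primitives of the profiles on `[a, a + 1]`: it climbs with slope `slope v`
from `0` at `a`, then descends with slope `-slope v` to `μ` at `a + 1`. -/
noncomputable def twoBranch (v : ℝ → ℝ) (μ a x : ℝ) : ℝ :=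
  min (∫ y in a..x, slope v y) (μ + ∫ y in x..(a + 1), slope v y)

lemma IsBarrier.exists_integral_abs_le (hψ : IsBarrier v p q κ θ ψ) (hθ : θ ∈ Ioo (0 : ℝ) 1)
    (hv : Continuous v) (hap : a ≤ p) (hpq : p ≤ q) (hqb : q ≤ b) (hu : IsProfile v μ d H u)
    (hM : ∀ x, |u x| + slope v x ≤ M)
    (hcross : ∀ x ∈ Icc p q, profileField d H (v x) (ψ x) < deriv ψ x) :
    ∃ z ∈ Icc a b, (∫ x in a..z, |u x - slope v x|) + ∫ x in z..b, |u x + slope v x|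
      ≤ M * (p - a) + M * (b - q) +
        (1 + θ) / (1 - θ) * ∫ x in p..q, |(|u x| - slope v x)| := by
  have hsc := continuous_slope hv
  have huc := hu.continuous
  have hψs := hψ.abs_le
  obtain ⟨z, hz, hbefore, hafter⟩ := exists_crossing_of_deriv_neg (f := fun x => u x - ψ x) hpq
    (fun x _ => (hu.hasDerivAt x).sub (hψ.contDiff.differentiable one_ne_zero x).hasDerivAt)
    (fun x hx hux => by rw [sub_eq_zero.1 hux]; exact sub_neg.2 (hcross x hx))
  have hgc : Continuous fun x => |(|u x| - slope v x)| := by fun_prop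
  have hleft := integral_le_add_mul_integral_add (f := fun x => |u x - slope v x|) (by fun_prop)
    hgc hap hz.1 le_rfl (fun x => (abs_sub _ _).trans <| by
      rw [abs_of_nonneg (slope_nonneg x)]; exact hM x)
    fun x hx => abs_sub_le_of_le_of_abs_le (slope_nonneg x) hθ
      (hψs x ⟨hx.1.le, hx.2.le.trans hz.2⟩) (sub_nonneg.1 (hbefore x ⟨hx.1.le, hx.2⟩))
  have hright := integral_le_add_mul_integral_add (f := fun x => |u x + slope v x|) (by fun_prop)
    hgc le_rfl hz.2 hqb (fun x => (abs_add_le _ _).trans <| by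
      rw [abs_of_nonneg (slope_nonneg x)]; exact hM x)
    fun x hx => abs_add_le_of_le_of_abs_le (slope_nonneg x) hθ
      (hψs x ⟨hz.1.trans hx.1.le, hx.2.le⟩) (sub_nonpos.1 (hafter x ⟨hx.1, hx.2.le⟩))
  refine ⟨z, ⟨hap.trans hz.1, hz.2.trans hqb⟩, (add_le_add hleft hright).trans_eq ?_⟩
  rw [← intervalIntegral.integral_add_adjacent_intervals (hgc.intervalIntegrable p z)
    (hgc.intervalIntegrable z q)]
  ring

lemma exists_uniform_abs_add_slope_le (hv : ContDiff ℝ 1 v) (hper : Function.Periodic v 1)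
    (hv0 : ∀ x, v x ≤ 0) (μ : ℝ) :
    ∃ M, ∀ d, 0 < d → ∀ H u, IsProfile v μ d H u → ∀ x, |u x| + slope v x ≤ M := by
  obtain ⟨M, _, hM⟩ := exists_uniform_bounds hv hper hv0 μ
  refine ⟨M, fun d hd H u hu x => ?_⟩
  have hslope : slope v x ≤ 1 - v x := Real.sqrt_le_iff.2 ⟨by linarith [hv0 x], by linarith⟩
  linarith [(hM d hd H u hu).1 x, abs_le_sqrt_one_add_sq (u x)]

lemma exists_forall_mem_Icc_lt_sq_lt_sq {A : ℝ} {D : ℝ → ℝ} (hv : Continuous v)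
    (hD : Continuous D) (hA : 0 ≤ A) (h : ∀ e ∈ Icc p q, v e = 0 → A < |D e|) :
    ∃ κ' > 0, A < κ' ^ 2 ∧ ∃ κ > κ', ∀ e ∈ Icc p q, v e = 0 → κ ^ 2 < |D e| := by
  have hK : IsCompact (Icc p q ∩ v ⁻¹' {0}) :=
    isCompact_Icc.inter_right (isClosed_singleton.preimage hv)
  obtain ⟨B, hAB, hB⟩ := hK.exists_forall_le' hD.abs.continuousOn fun e he => h e he.1 he.2
  obtain ⟨κ, hκ0, hAκ, hκB⟩ := exists_lt_sq_lt (hA.trans_lt hAB) hAB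
  obtain ⟨κ', hκ'0, hAκ', hκ'κ⟩ := exists_lt_sq_lt (by positivity) hAκ
  exact ⟨κ', hκ'0, hAκ', κ, lt_of_pow_lt_pow_left₀ 2 hκ0.le hκ'κ,
    fun e he hve => hκB.trans_le (hB e ⟨he, hve⟩)⟩

lemma eventually_exists_integral_abs_le (hv : ContDiff ℝ 2 v) (hper : Function.Periodic v 1)
    (hv0 : ∀ x, v x ≤ 0) (hμ : |μ| < ∫ y in (0 : ℝ)..1, slope v y) (ha : v a = 0)
    (hflat : ∀ e ∈ Ioo a (a + 1), v e = 0 → |deriv (deriv v) a| < |deriv (deriv v) e|)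
    {ε : ℝ} (hε : 0 < ε) :
    ∀ᶠ d in 𝓝[>] (0 : ℝ), ∀ H u, IsProfile v μ d H u → ∃ z ∈ Icc a (a + 1),
      (∫ x in a..z, |u x - slope v x|) + ∫ x in z..(a + 1), |u x + slope v x| ≤ ε := by
  have hv1 : ContDiff ℝ 1 v := hv.of_le one_le_two
  obtain ⟨M, hM⟩ := exists_uniform_abs_add_slope_le hv1 hper hv0 μ
  obtain ⟨δ, hδM, hδ0, hδ⟩ := ((eventually_mul_lt (2 * M) (half_pos hε)).and
    (Ioo_mem_nhdsGT (half_pos one_pos))).exists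
  have hsub : Icc (a + δ) (a + 1 - δ) ⊆ Ioo a (a + 1) :=
    Icc_subset_Ioo (by linarith) (by linarith)
  obtain ⟨κ', hκ'0, hκ', κ, hκκ', hκ⟩ := exists_forall_mem_Icc_lt_sq_lt_sq hv.continuous
    (hv.iterate_deriv' 0 2).continuous (abs_nonneg _) fun e he => hflat e (hsub he)
  obtain ⟨θ, hθ, ψ, hψ⟩ := exists_isBarrier hv hv0 hκ
  have hK : 0 < (1 + θ) / (1 - θ) := div_pos (by linarith [hθ.1]) (by linarith [hθ.2])
  filter_upwards [self_mem_nhdsWithin, eventually_one_sub_level_le hv hper hv0 hμ ha hκ'0 hκ',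
    hψ.eventually_profileField_lt_deriv hθ.2 hv.continuous hv0 hκκ',
    eventually_integral_abs_abs_sub_slope_le hv1 hper hv0 ha hμ a
      (ε := ε / 2 / ((1 + θ) / (1 - θ))) (by positivity)]
    with d hd hlevel hcross hint H u hu
  obtain ⟨z, hz, hzle⟩ := hψ.exists_integral_abs_le hθ hv.continuous (b := a + 1)
    (by linarith : a ≤ a + δ) (by linarith) (by linarith) hu (hM d hd H u hu)
    (hcross H (hlevel H u hu))
  refine ⟨z, hz, hzle.trans ?_⟩
  have hgc : Continuous fun x => |(|u x| - slope v x)| :=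
    (hu.continuous.abs.sub (continuous_slope hv.continuous)).abs
  have hinner : ∫ x in (a + δ)..(a + 1 - δ), |(|u x| - slope v x)|
      ≤ ε / 2 / ((1 + θ) / (1 - θ)) :=
    (intervalIntegral.integral_mono_interval (by linarith) (by linarith) (by linarith)
      (Eventually.of_forall fun x => abs_nonneg _) (hgc.intervalIntegrable _ _)).trans (hint H u hu)
  rw [le_div_iff₀' hK] at hinner
  linarith

lemma eventually_abs_integral_sub_twoBranch_le (hv : ContDiff ℝ 2 v)
    (hper : Function.Periodic v 1) (hv0 : ∀ x, v x ≤ 0)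
    (hμ : |μ| < ∫ y in (0 : ℝ)..1, slope v y) (ha : v a = 0)
    (hflat : ∀ e ∈ Ioo a (a + 1), v e = 0 → |deriv (deriv v) a| < |deriv (deriv v) e|)
    {ε : ℝ} (hε : 0 < ε) :
    ∀ᶠ d in 𝓝[>] (0 : ℝ), ∀ H u, IsProfile v μ d H u → ∀ x ∈ Icc a (a + 1),
      |(∫ y in a..x, u y) - twoBranch v μ a x| ≤ ε := by
  filter_upwards [eventually_exists_integral_abs_le hv hper hv0 hμ ha hflat (half_pos hε)]
    with d hd H u hu x hx
  obtain ⟨z, hz, hzε⟩ := hd H u hu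
  have hmean : ∫ y in a..(a + 1), u y = μ := by
    rw [hu.periodic.intervalIntegral_add_eq a 0, zero_add, hu.mean]
  have h := abs_integral_sub_min_le hu.continuous (continuous_slope hv.continuous) slope_nonneg
    hz hzε hx
  rwa [hmean, mul_div_cancel₀ _ two_ne_zero] at h

end limit

lemma nonpos_of_hasDerivWithinAt_Ici {f : ℝ → ℝ} {c y : ℝ} (hf : HasDerivWithinAt f c (Ici y) y)
    (hmax : IsLocalMax f y) : c ≤ 0 := by
  have hone : (1 : ℝ) ∈ posTangentConeAt (Ici y) y :=
    mem_posTangentConeAt_of_segment_subset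
      ((convex_Ici y).segment_subset self_mem_Ici (by simp : y + 1 ∈ Ici y))
  simpa using (hmax.on (Ici y)).hasFDerivWithinAt_nonpos hf hone

lemma nonneg_of_hasDerivWithinAt_Iic {f : ℝ → ℝ} {c y : ℝ} (hf : HasDerivWithinAt f c (Iic y) y)
    (hmax : IsLocalMax f y) : 0 ≤ c := by
  have hneg : (-1 : ℝ) ∈ posTangentConeAt (Iic y) y :=
    mem_posTangentConeAt_of_segment_subset
      ((convex_Iic y).segment_subset self_mem_Iic (by simp : y + -1 ∈ Iic y))
  simpa using (hmax.on (Iic y)).hasFDerivWithinAt_nonpos hf hneg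

lemma isInviscidViscositySolution_of_hasDerivWithinAt {v w : ℝ → ℝ} {μ : ℝ} (hv0 : ∀ x, v x ≤ 0)
    (hw : ∀ y, ∃ l r, HasDerivWithinAt w l (Iic y) y ∧ HasDerivWithinAt w r (Ici y) y ∧ r ≤ l ∧
      |μ + l| = slope v y ∧ |μ + r| = slope v y) : IsInviscidViscositySolution v μ 1 w := by
  refine ⟨continuous_iff_continuousAt.2 fun y => ?_, fun φ y hφ hmax => ?_, fun φ y hφ hmin => ?_⟩
  · obtain ⟨l, r, hl, hr, -⟩ := hw y
    exact continuousAt_iff_continuous_left_right.2 ⟨hl.continuousWithinAt, hr.continuousWithinAt⟩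
  · obtain ⟨l, r, hl, hr, -, hls, hrs⟩ := hw y
    have hφ' := (hφ.differentiable one_ne_zero y).hasDerivAt
    have hle := nonneg_of_hasDerivWithinAt_Iic (hl.sub hφ'.hasDerivWithinAt) hmax
    have hge := nonpos_of_hasDerivWithinAt_Ici (hr.sub hφ'.hasDerivWithinAt) hmax
    have habs : |μ + deriv φ y| ≤ slope v y := by
      simpa only [hrs, hls, max_self] using abs_le_max_abs_abs
        (add_le_add_right (sub_nonpos.1 hge) μ) (add_le_add_right (sub_nonneg.1 hle) μ)
    linarith [(sqrt_one_add_sq_le_iff_abs_le_slope hv0).2 habs]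
  · obtain ⟨l, r, hl, hr, hrl, hls, -⟩ := hw y
    have hφ' := (hφ.differentiable one_ne_zero y).hasDerivAt
    have hmax : IsLocalMax (fun x => φ x - w x) y := by simpa using hmin.neg
    have hge := nonneg_of_hasDerivWithinAt_Iic (hφ'.hasDerivWithinAt.sub hl) hmax
    have hle := nonpos_of_hasDerivWithinAt_Ici (hφ'.hasDerivWithinAt.sub hr) hmax
    have heq : deriv φ y = l := by linarith
    linarith [(le_sqrt_one_add_sq_iff_slope_le_abs hv0).2 (heq ▸ hls.ge)]

section physical

variable {v : ℝ → ℝ} {μ a z : ℝ}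

lemma hasDerivAt_integral_slope (hv : Continuous v) (a x : ℝ) :
    HasDerivAt (fun t => ∫ y in a..t, slope v y) (slope v x) x :=
  (continuous_slope hv).integral_hasStrictDerivAt a x |>.hasDerivAt

lemma integral_slope_add_integral_slope (hv : Continuous v) (x y t : ℝ) :
    (∫ s in x..y, slope v s) + ∫ s in y..t, slope v s = ∫ s in x..t, slope v s :=
  intervalIntegral.integral_add_adjacent_intervals ((continuous_slope hv).intervalIntegrable x y)
    ((continuous_slope hv).intervalIntegrable y t)

lemma integral_slope_nonneg {x y : ℝ} (hxy : x ≤ y) : 0 ≤ ∫ t in x..y, slope v t :=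
  intervalIntegral.integral_nonneg hxy fun t _ => slope_nonneg t

lemma integral_slope_pos (hv : Continuous v) (hv0 : ∀ x, v x ≤ 0) {x y : ℝ} (hxy : x < y)
    (hne : ∀ e ∈ Ioo x y, v e = 0 → deriv (deriv v) e ≠ 0) : 0 < ∫ t in x..y, slope v t := by
  refine intervalIntegral.integral_pos hxy (continuous_slope hv).continuousOn
    (fun t _ => slope_nonneg t) ?_
  by_contra! hslope
  have hzero : ∀ t ∈ Ioo x y, v t = 0 := fun t ht =>
    (slope_eq_zero_iff hv0).1 ((hslope t (Ioo_subset_Icc_self ht)).antisymm (slope_nonneg t))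
  obtain ⟨e, he⟩ := exists_between hxy
  have hev : v =ᶠ[𝓝 e] fun _ => 0 := eventually_of_mem (isOpen_Ioo.mem_nhds he) hzero
  exact hne e he (hzero e he) (by simpa using hev.deriv.deriv_eq)

lemma exists_isBalanced (hv : Continuous v) (hper : Function.Periodic v 1) (hv0 : ∀ x, v x ≤ 0)
    (hμ : |μ| < ∫ y in (0 : ℝ)..1, slope v y)
    (hne : ∀ e ∈ Ioo a (a + 1), v e = 0 → deriv (deriv v) e ≠ 0) :
    ∃ z ∈ Ioo a (a + 1), IsBalanced v μ a z ∧
      ∀ z' ∈ Ioo a (a + 1), IsBalanced v μ a z' → z' = z := by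
  set F := fun x => (∫ y in a..x, slope v y) - ∫ y in x..(a + 1), slope v y
  have hcell : ∫ y in a..(a + 1), slope v y = ∫ y in (0 : ℝ)..1, slope v y := by
    simpa using (periodic_slope hper).intervalIntegral_add_eq a 0
  have hF : ∀ x, F x = 2 * (∫ y in a..x, slope v y) - ∫ y in (0 : ℝ)..1, slope v y := fun x => by
    rw [← hcell, ← integral_slope_add_integral_slope hv a x (a + 1)]
    ring
  have hmono : StrictMonoOn F (Icc a (a + 1)) := fun x hx y hy hxy => by
    have hpos := integral_slope_pos hv hv0 hxy fun e he =>
      hne e ⟨hx.1.trans_lt he.1, he.2.trans_le hy.2⟩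
    rw [hF, hF, ← integral_slope_add_integral_slope hv a x y]
    linarith
  have hcont : Continuous F := by
    rw [funext hF]
    exact continuous_iff_continuousAt.2 fun x =>
      (((hasDerivAt_integral_slope hv a x).const_mul 2).sub_const _).continuousAt
  obtain ⟨z, hz, hFz⟩ := intermediate_value_Ioo (lt_add_one a).le hcont.continuousOn
    (show μ ∈ Ioo (F a) (F (a + 1)) by simpa [F, hcell] using abs_lt.1 hμ)
  exact ⟨z, hz, hFz, fun z' hz' hbal => hmono.injOn (Ioo_subset_Icc_self hz')
    (Ioo_subset_Icc_self hz) (hbal.trans hFz.symm)⟩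

lemma periodic_physicalSolution : Function.Periodic (physicalSolution v μ a z) 1 := fun x =>
  congrArg (cellProfile v μ a z) (toIcoMod_add_right _ a x)

lemma IsBalanced.cellProfile_add_one (hbal : IsBalanced v μ a z) (hz : z ∈ Ioo a (a + 1)) :
    cellProfile v μ a z (a + 1) = cellProfile v μ a z a := by
  rw [cellProfile, cellProfile, if_neg hz.2.not_ge, if_pos hz.1.le, hbal,
    intervalIntegral.integral_same]
  ring

lemma IsBalanced.physicalSolution_eq_cellProfile (hbal : IsBalanced v μ a z)
    (hz : z ∈ Ioo a (a + 1)) {x : ℝ} (hx : x ∈ Icc a (a + 1)) :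
    physicalSolution v μ a z x = cellProfile v μ a z x := by
  rw [physicalSolution]
  rcases hx.2.lt_or_eq with hlt | rfl
  · rw [(toIcoMod_eq_self _).2 ⟨hx.1, hlt⟩]
  · rw [toIcoMod_apply_right, hbal.cellProfile_add_one hz]

lemma IsBalanced.cellProfile_eq_twoBranch_sub (hv : Continuous v) (hbal : IsBalanced v μ a z)
    (x : ℝ) : cellProfile v μ a z x = twoBranch v μ a x - μ * x := by
  rw [IsBalanced] at hbal
  have hsplit := integral_slope_add_integral_slope hv
  rw [cellProfile, twoBranch]
  split_ifs with hxz
  · have hnonneg := integral_slope_nonneg (v := v) hxz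
    rw [min_eq_left (by linarith [hsplit a x z, hsplit x z (a + 1)])]
  · have hnonneg := integral_slope_nonneg (v := v) (not_le.1 hxz).le
    rw [min_eq_right (by linarith [hsplit a z x, hsplit z x (a + 1)])]
    linarith [hsplit z x (a + 1)]

lemma IsBalanced.physicalSolution_eq_cellProfile_sub (hbal : IsBalanced v μ a z)
    (hz : z ∈ Ioo a (a + 1)) {x : ℝ} (n : ℤ) (hx : x ∈ Icc (a + n) (a + 1 + n)) :
    physicalSolution v μ a z x = cellProfile v μ a z (x - n) := by
  rw [← hbal.physicalSolution_eq_cellProfile hz ⟨by linarith [hx.1], by linarith [hx.2]⟩]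
  simpa using (periodic_physicalSolution.sub_int_mul_eq n).symm

lemma IsBalanced.hasDerivWithinAt_physicalSolution_left (hbal : IsBalanced v μ a z)
    (hz : z ∈ Ioo a (a + 1)) (hv : Continuous v) (hper : Function.Periodic v 1) (n : ℤ) {y : ℝ}
    (hy : y ∈ Icc (a + n) (z + n)) : HasDerivWithinAt (physicalSolution v μ a z)
      (slope v y - μ) (Icc (a + n) (z + n)) y := by
  have heq : ∀ x ∈ Icc (a + n) (z + n), physicalSolution v μ a z x =
      (∫ t in a..(x - n), slope v t) - μ * (x - n) := fun x hx => by
    rw [hbal.physicalSolution_eq_cellProfile_sub hz n ⟨hx.1, hx.2.trans (by linarith [hz.2])⟩,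
      cellProfile, if_pos (by linarith [hx.2])]
  have hslope : slope v (y - n) = slope v y := by
    simpa using (periodic_slope hper).sub_int_mul_eq n
  have hderiv := ((hasDerivAt_integral_slope hv a (y - n)).sub
    ((hasDerivAt_id (y - n)).const_mul μ)).comp_sub_const y n
  rw [hslope, mul_one] at hderiv
  exact hderiv.hasDerivWithinAt.congr heq (heq y hy)

lemma IsBalanced.hasDerivWithinAt_physicalSolution_right (hbal : IsBalanced v μ a z)
    (hz : z ∈ Ioo a (a + 1)) (hv : Continuous v) (hper : Function.Periodic v 1) (n : ℤ) {y : ℝ}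
    (hy : y ∈ Icc (z + n) (a + 1 + n)) : HasDerivWithinAt (physicalSolution v μ a z)
      (-slope v y - μ) (Icc (z + n) (a + 1 + n)) y := by
  have heq : ∀ x ∈ Icc (z + n) (a + 1 + n), physicalSolution v μ a z x =
      (∫ t in a..z, slope v t) - (∫ t in z..(x - n), slope v t) - μ * (x - n) := fun x hx => by
    rw [hbal.physicalSolution_eq_cellProfile_sub hz n ⟨by linarith [hz.1, hx.1], hx.2⟩,
      cellProfile]
    split_ifs with hxz
    · rw [show x - n = z by linarith [hx.1], intervalIntegral.integral_same, sub_zero]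
    · rfl
  have hslope : slope v (y - n) = slope v y := by
    simpa using (periodic_slope hper).sub_int_mul_eq n
  have hderiv := (((hasDerivAt_integral_slope hv z (y - n)).const_sub
    (∫ t in a..z, slope v t)).sub ((hasDerivAt_id (y - n)).const_mul μ)).comp_sub_const y n
  rw [hslope, mul_one] at hderiv
  exact hderiv.hasDerivWithinAt.congr heq (heq y hy)

lemma IsBalanced.isInviscidViscositySolution (hbal : IsBalanced v μ a z)
    (hz : z ∈ Ioo a (a + 1)) (hv : Continuous v) (hper : Function.Periodic v 1)
    (hv0 : ∀ x, v x ≤ 0) (ha : v a = 0) :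
    IsInviscidViscositySolution v μ 1 (physicalSolution v μ a z) := by
  refine isInviscidViscositySolution_of_hasDerivWithinAt hv0 fun y => ?_
  have hup := fun n => hbal.hasDerivWithinAt_physicalSolution_left hz hv hper n (y := y)
  have hdown := fun n => hbal.hasDerivWithinAt_physicalSolution_right hz hv hper n (y := y)
  have hup_left := fun (n : ℤ) (hy : y ∈ Ioc (a + n) (z + n)) =>
    (hup n (Ioc_subset_Icc_self hy)).mono_of_mem_nhdsWithin (Icc_mem_nhdsLE_of_mem hy)
  have hup_right := fun (n : ℤ) (hy : y ∈ Ico (a + n) (z + n)) =>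
    (hup n (Ico_subset_Icc_self hy)).mono_of_mem_nhdsWithin (Icc_mem_nhdsGE_of_mem hy)
  have hdown_left := fun (n : ℤ) (hy : y ∈ Ioc (z + n) (a + 1 + n)) =>
    (hdown n (Ioc_subset_Icc_self hy)).mono_of_mem_nhdsWithin (Icc_mem_nhdsLE_of_mem hy)
  have hdown_right := fun (n : ℤ) (hy : y ∈ Ico (z + n) (a + 1 + n)) =>
    (hdown n (Ico_subset_Icc_self hy)).mono_of_mem_nhdsWithin (Icc_mem_nhdsGE_of_mem hy)
  have hs := slope_nonneg (v := v) y
  have habs_up : |μ + (slope v y - μ)| = slope v y := by rw [add_sub_cancel, abs_of_nonneg hs]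
  have habs_down : |μ + (-slope v y - μ)| = slope v y := by
    rw [add_sub_cancel, abs_neg, abs_of_nonneg hs]
  obtain ⟨n, hny, hyn⟩ : ∃ n : ℤ, a + n ≤ y ∧ y < a + 1 + n :=
    ⟨⌊y - a⌋, by linarith [Int.floor_le (y - a)], by linarith [Int.lt_floor_add_one (y - a)]⟩
  rcases hny.eq_or_lt with hay | hay
  · have hslope : slope v y = 0 := by
      rw [slope_eq_zero_iff hv0, ← ha, ← hay]
      simpa using hper.int_mul n a
    exact ⟨_, _, hdown_left (n - 1) (by push_cast; constructor <;> linarith [hz.2]),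
      hup_right n ⟨hny, by linarith [hz.1]⟩, by linarith, habs_down, habs_up⟩
  rcases lt_trichotomy y (z + n) with hyz | hyz | hyz
  · exact ⟨_, _, hup_left n ⟨hay, hyz.le⟩, hup_right n ⟨hny, hyz⟩, le_rfl, habs_up, habs_up⟩
  · exact ⟨_, _, hup_left n ⟨hay, hyz.le⟩, hdown_right n ⟨hyz.ge, hyn⟩, by linarith, habs_up,
      habs_down⟩
  · exact ⟨_, _, hdown_left n ⟨hyz, hyn.le⟩, hdown_right n ⟨hyz.le, hyn⟩, le_rfl, habs_down,
      habs_down⟩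

end physical

section maxPoints

variable {v : ℝ → ℝ} {a : ℝ}

lemma mem_maxPoints_iff (hmax : IsGreatest (range v) 0) {x : ℝ} :
    x ∈ maxPoints v ↔ x ∈ Ico (0 : ℝ) 1 ∧ v x = 0 := by
  obtain ⟨⟨x₀, hx₀⟩, hv0⟩ := hmax
  refine and_congr_right fun _ => ⟨fun h => ?_, fun h y => h ▸ hv0 (mem_range_self y)⟩
  exact (hv0 (mem_range_self x)).antisymm (hx₀ ▸ h x₀)

lemma exists_mem_maxPoints_sub_int (hper : Function.Periodic v 1) (hmax : IsGreatest (range v) 0)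
    {x : ℝ} (hx : v x = 0) : ∃ n : ℤ, x - n ∈ maxPoints v :=
  ⟨⌊x⌋, (mem_maxPoints_iff hmax).2 ⟨⟨Int.fract_nonneg x, Int.fract_lt_one x⟩, by
    simpa only [mul_one, hx] using hper.sub_int_mul_eq (x := x) ⌊x⌋⟩⟩

lemma exists_flattest_maxPoint (hv : ContDiff ℝ 2 v) (hper : Function.Periodic v 1)
    (hmax : IsGreatest (range v) 0) (hdistinct : InjOn (deriv (deriv v)) (maxPoints v)) :
    ∃ a ∈ maxPoints v, ∀ y ∈ maxPoints v, y ≠ a → |deriv (deriv v) a| < |deriv (deriv v) y| := by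
  have hmem := fun x => mem_maxPoints_iff hmax (x := x)
  have hnonpos : ∀ x ∈ maxPoints v, deriv (deriv v) x ≤ 0 := fun x hx =>
    deriv_deriv_nonpos_of_isLocalMax hv.continuous.continuousAt (Eventually.of_forall hx.2)
  obtain ⟨x₀, hx₀⟩ := hmax.1
  obtain ⟨n₀, hn₀⟩ := exists_mem_maxPoints_sub_int hper hmax hx₀
  have hK : IsCompact (Icc (0 : ℝ) 1 ∩ v ⁻¹' {0}) :=
    isCompact_Icc.inter_right (isClosed_singleton.preimage hv.continuous)
  have hsub : maxPoints v ⊆ Icc (0 : ℝ) 1 ∩ v ⁻¹' {0} := fun x hx =>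
    ⟨Ico_subset_Icc_self hx.1, ((hmem x).1 hx).2⟩
  obtain ⟨e, he, hmin⟩ := hK.exists_isMinOn ⟨_, hsub hn₀⟩
    (hv.iterate_deriv' 0 2).continuous.abs.continuousOn
  obtain ⟨n, hn⟩ := exists_mem_maxPoints_sub_int hper hmax he.2
  have hshift : deriv (deriv v) (e - n) = deriv (deriv v) e := by
    simpa using (periodic_deriv (periodic_deriv hper)).sub_int_mul_eq n
  refine ⟨e - n, hn, fun y hy hne => ?_⟩
  have hle : |deriv (deriv v) (e - n)| ≤ |deriv (deriv v) y| := hshift ▸ hmin (hsub hy)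
  refine hle.lt_of_ne fun heq => hne (hdistinct hy hn ?_)
  rw [abs_of_nonpos (hnonpos _ hn), abs_of_nonpos (hnonpos _ hy)] at heq
  exact (neg_inj.1 heq).symm

lemma abs_deriv_deriv_lt_of_mem_Ioo (hper : Function.Periodic v 1) (hmax : IsGreatest (range v) 0)
    (hflat : ∀ y ∈ maxPoints v, y ≠ a → |deriv (deriv v) a| < |deriv (deriv v) y|) {e : ℝ}
    (he : e ∈ Ioo a (a + 1)) (hve : v e = 0) : |deriv (deriv v) a| < |deriv (deriv v) e| := by
  obtain ⟨n, hn⟩ := exists_mem_maxPoints_sub_int hper hmax hve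
  have hshift : deriv (deriv v) (e - n) = deriv (deriv v) e := by
    simpa using (periodic_deriv (periodic_deriv hper)).sub_int_mul_eq n
  refine hshift ▸ hflat _ hn fun hea => ?_
  have hn0 : (0 : ℝ) < n := by linarith [he.1]
  have hn1 : (n : ℝ) < 1 := by linarith [he.2]
  norm_cast at hn0 hn1
  omega

end maxPoints

section convergence

variable {v w : ℝ → ℝ} {μ a z d H ε : ℝ}

lemma IsCellSolution.integral_eq (hw : IsCellSolution v μ d H w) (x y : ℝ) :
    ∫ t in x..y, (μ + deriv w t) = (w y + μ * y) - (w x + μ * x) := by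
  have hw' : Continuous (deriv w) := hw.contDiff.continuous_deriv one_le_two
  have hderiv : ∀ t, HasDerivAt (fun t => w t + μ * t) (μ + deriv w t) t := fun t =>
    ((hw.contDiff.differentiable two_ne_zero t).hasDerivAt.add
      ((hasDerivAt_id t).const_mul μ)).congr_deriv (by ring)
  exact intervalIntegral.integral_eq_sub_of_hasDerivAt (fun t _ => hderiv t)
    ((continuous_const.add hw').intervalIntegrable x y)

lemma IsCellSolution.abs_sub_physicalSolution_le (hw : IsCellSolution v μ d H w)
    (hv : Continuous v) (hz : z ∈ Ioo a (a + 1)) (hbal : IsBalanced v μ a z)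
    (hint : ∀ x ∈ Icc a (a + 1), |(∫ y in a..x, (μ + deriv w y)) - twoBranch v μ a x| ≤ ε)
    (x : ℝ) : |w x - (physicalSolution v μ a z x - physicalSolution v μ a z 0)| ≤ 2 * ε := by
  set g := fun x => w x - physicalSolution v μ a z x
  have hg : Function.Periodic g 1 := fun x => by
    simp only [g, hw.periodic x, periodic_physicalSolution x]
  have hcell : ∀ x ∈ Icc a (a + 1), |g x - g a| ≤ ε := fun x hx => by
    have ha : a ∈ Icc a (a + 1) := left_mem_Icc.2 (lt_add_one a).le
    have hphys : ∀ x ∈ Icc a (a + 1), twoBranch v μ a x = physicalSolution v μ a z x + μ * x :=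
      fun x hx => by
        rw [hbal.physicalSolution_eq_cellProfile hz hx, hbal.cellProfile_eq_twoBranch_sub hv,
          sub_add_cancel]
    have hzero : physicalSolution v μ a z a + μ * a = 0 := by
      rw [hbal.physicalSolution_eq_cellProfile hz ha, cellProfile, if_pos hz.1.le,
        intervalIntegral.integral_same]
      ring
    have h := hint x hx
    rw [hw.integral_eq, hphys x hx] at h
    convert h using 2
    simp only [g]
    linarith
  have hall : ∀ x, |g x - g a| ≤ ε := fun x => by
    obtain ⟨y, hy, hxy⟩ := hg.exists_mem_Ico one_pos x a
    exact hxy ▸ hcell y (Ico_subset_Icc_self hy)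
  calc |w x - (physicalSolution v μ a z x - physicalSolution v μ a z 0)|
      = |g x - g 0| := by simp only [g, hw.normalized]; congr 1; ring
    _ ≤ |g x - g a| + |g a - g 0| := abs_sub_le _ _ _
    _ ≤ 2 * ε := by rw [abs_sub_comm (g a)]; linarith [hall x, hall 0]

lemma tendstoUniformly_physicalSolution (hv : ContDiff ℝ 2 v) (hper : Function.Periodic v 1)
    (hv0 : ∀ x, v x ≤ 0) (hμ : |μ| < ∫ y in (0 : ℝ)..1, slope v y) (ha : v a = 0)
    (hflat : ∀ e ∈ Ioo a (a + 1), v e = 0 → |deriv (deriv v) a| < |deriv (deriv v) e|)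
    (hz : z ∈ Ioo a (a + 1)) (hbal : IsBalanced v μ a z) {H : ℝ → ℝ} {w : ℝ → ℝ → ℝ}
    (hw : ∀ d : ℝ, 0 < d → IsCellSolution v μ d (H d) (w d)) :
    TendstoUniformly w (fun x => physicalSolution v μ a z x - physicalSolution v μ a z 0)
      (𝓝[>] (0 : ℝ)) := by
  rw [Metric.tendstoUniformly_iff]
  intro ε hε
  filter_upwards [self_mem_nhdsWithin, eventually_abs_integral_sub_twoBranch_le hv hper hv0 hμ ha
    hflat (show 0 < ε / 3 by positivity)] with d hd hint x
  have hle := (hw d hd).abs_sub_physicalSolution_le hv.continuous hz hbal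
    (hint _ _ ((hw d hd).isProfile hd)) x
  rw [dist_comm, Real.dist_eq]
  linarith

end convergence

end GEquation

open GEquation in
theorem theorem1p2_general (v : ℝ → ℝ) (μ : ℝ)
    (hv : ContDiff ℝ 2 v) (hper : Function.Periodic v 1)
    (hmax : IsGreatest (Set.range v) 0)
    (hμ : |μ| < ∫ y in (0 : ℝ)..1, √((1 - v y) ^ 2 - 1))
    (hdistinct : Set.InjOn (deriv (deriv v)) (maxPoints v)) :
    (∀ d : ℝ, 0 < d → ∃! Hw : ℝ × (ℝ → ℝ), IsCellSolution v μ d Hw.1 Hw.2) ∧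
    ∃ xbar ∈ maxPoints v,
      (∀ y ∈ maxPoints v, y ≠ xbar → |deriv (deriv v) xbar| < |deriv (deriv v) y|) ∧
      ∃ xμ ∈ Set.Ioo xbar (xbar + 1),
        IsBalanced v μ xbar xμ ∧
        (∀ z ∈ Set.Ioo xbar (xbar + 1), IsBalanced v μ xbar z → z = xμ) ∧
        (∀ x ∈ Set.Icc xbar (xbar + 1),
          physicalSolution v μ xbar xμ x = cellProfile v μ xbar xμ x) ∧
        IsInviscidViscositySolution v μ 1 (physicalSolution v μ xbar xμ) ∧
        ∀ (H : ℝ → ℝ) (w : ℝ → ℝ → ℝ),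
          (∀ d : ℝ, 0 < d → IsCellSolution v μ d (H d) (w d)) →
          TendstoUniformly w
            (fun x => physicalSolution v μ xbar xμ x - physicalSolution v μ xbar xμ 0)
            (𝓝[>] (0 : ℝ)) := by
  have hvc := hv.continuous
  have hv0 : ∀ x, v x ≤ 0 := fun x => hmax.2 (mem_range_self x)
  obtain ⟨a, ha, hmin⟩ := exists_flattest_maxPoint hv hper hmax hdistinct
  have hva : v a = 0 := ((mem_maxPoints_iff hmax).1 ha).2
  have hflat : ∀ e ∈ Ioo a (a + 1), v e = 0 → |deriv (deriv v) a| < |deriv (deriv v) e| :=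
    fun e he hve => abs_deriv_deriv_lt_of_mem_Ioo hper hmax hmin he hve
  obtain ⟨z, hz, hbal, huniq⟩ := exists_isBalanced hvc hper hv0 hμ
    fun e he hve => abs_pos.1 ((abs_nonneg _).trans_lt (hflat e he hve))
  exact ⟨fun d hd => existsUnique_isCellSolution hvc hper μ hd, a, ha, hmin, z, hz, hbal, huniq,
    fun x hx => hbal.physicalSolution_eq_cellProfile hz hx,
    hbal.isInviscidViscositySolution hz hvc hper hv0 hva,
    fun H w hw => tendstoUniformly_physicalSolution hv hper hv0 hμ hva hflat hz hbal hw⟩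

open GEquation in
theorem theorem1p2 (v : ℝ → ℝ) (μ : ℝ)
    (hv : ContDiff ℝ (⊤ : ℕ∞) v) (hper : Function.Periodic v 1)
    (hmax : IsGreatest (Set.range v) 0)
    (hμ : |μ| < ∫ y in (0 : ℝ)..1, √((1 - v y) ^ 2 - 1))
    (hfin : (maxPoints v).Finite)
    (hdistinct : Set.InjOn (deriv (deriv v)) (maxPoints v)) :
    (∀ d : ℝ, 0 < d → ∃! Hw : ℝ × (ℝ → ℝ), IsCellSolution v μ d Hw.1 Hw.2) ∧
    ∃ xbar ∈ maxPoints v,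
      (∀ y ∈ maxPoints v, y ≠ xbar → |deriv (deriv v) xbar| < |deriv (deriv v) y|) ∧
      ∃ xμ ∈ Set.Ioo xbar (xbar + 1),
        IsBalanced v μ xbar xμ ∧
        (∀ z ∈ Set.Ioo xbar (xbar + 1), IsBalanced v μ xbar z → z = xμ) ∧
        (∀ x ∈ Set.Icc xbar (xbar + 1),
          physicalSolution v μ xbar xμ x = cellProfile v μ xbar xμ x) ∧
        IsInviscidViscositySolution v μ 1 (physicalSolution v μ xbar xμ) ∧
        ∀ (H : ℝ → ℝ) (w : ℝ → ℝ → ℝ),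
          (∀ d : ℝ, 0 < d → IsCellSolution v μ d (H d) (w d)) →
          TendstoUniformly w
            (fun x => physicalSolution v μ xbar xμ x - physicalSolution v μ xbar xμ 0)
            (𝓝[>] (0 : ℝ)) :=
  theorem1p2_general v μ (contDiff_infty.1 hv 2) hper hmax hμ hdistinct
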